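/- All data are $C^\infty$; $M$ is a smooth finite-dimensional (Hausdorff) manifold without boundary. Let $X$ be a vector field on $M$, $\mathcal D$ a distribution of rank $2m$ on $M$, $\mathcal V\subset\mathcal D$ a sub-distribution of rank $m$, and $\sigma$ a non-degenerate skew-symmetric $2$-form on $\mathcal D$. The quadruple $(X,\mathcal V,\mathcal D,\sigma)$ is called regular semi-Hamiltonian if - $[X,\mathcal D]\subset\mathcal D$ and $X(\sigma(Y,Z))=\sigma([X,Y],Z)+\sigma(Y,[X,Z])$ for all local sections $Y,Z$ of $\mathcal D$; - $\mathcal V$ is Lagrangian: $\sigma_x(v,w)=0$ for all $x\in M$ and $v,w\in\mathcal V(x)$; - $X(x)\ne0$ for all $x\in M$, and $\mathcal V+[X,\mathcal V]=\mathcal D$ (so this sum has the maximal possible rank $2m$). For such a quadruple let $g$ be the bilinear form on $\mathcal V$ given by $g(V,W)=\sigma([X,V],W)$ for sections $V,W$ of $\mathcal V$ (it is tensorial). For a local frame $\hat V=(V_1,\dots,V_m)$ of $\mathcal V$ write $[X,[X,\hat V]]=\hat VH_0+[X,\hat V]H_1$ with $m\times m$ matrices $H_0,H_1$ of functions. The curvature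 operator $K_x:\mathcal V(x)\to\mathcal V(x)$ is the linear operator whose matrix in the frame $\hat V$ is $-H_0+\tfrac12X(H_1)-\tfrac14H_1^2$ (it does not depend on the frame). The directional curvature is $k(v)=g(Kv,v)/g(v,v)$, for $v\in\mathcal V(x)$ with $g(v,v)\ne0$. Given an integral curve $c:[0,T]\to M$ of $X$, a time $t^*\in(0,T]$ is a conjugate time along $c$ if $\exp(t^*X)_*\mathcal V(c(0))\cap\mathcal V(c(t^*))\ne\{0\}$, where $\exp(tX)$ is the local flow of $X$. Theorem. Let $(X,\mathcal V,\mathcal D,\sigma)$ be a regular semi-Hamiltonian quadruple on $M$, let $c:[0,T]\to M$ be an integral curve of $X$ and let $\lambda\in\mathbb R$. Assume that (A) $g$ is strictly definite (positive or negative) on $\mathcal V(c(t))$ for every $t\in[0,T]$; (B) $k(v)\le\lambda$ for all $v\in\mathcal V(c(t))\setminus\{0\}$ and all $t\in[0,T]$. Then there are no conjugate times in $(0,T]$ if $\lambda\le0$, and there are no conjugate times in $(0,\min\{T,\pi/\sqrt\lambda\})$ if $\lambda>0$. -/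

import Mathlib

open Set Filter Topology Manifold ContDiff

noncomputable section

namespace DynamicPair

variable {E : Type*} [NormedAddCommGroup E] [NormedSpace ℝ E]
  {M : Type*} [TopologicalSpace M] [ChartedSpace E M]

/-- Vector fields on a manifold modelled on `E` (no smoothness required). -/
abbrev VField (E : Type*) [NormedAddCommGroup E] [NormedSpace ℝ E]
    (M : Type*) [TopologicalSpace M] [ChartedSpace E M] : Type _ :=
  (x : M) → TangentSpace 𝓘(ℝ, E) x

/-- Fields of tangent subspaces (no smoothness and no constancy of rank required). -/
abbrev PlaneField (E : Type*) [NormedAddCommGroup E] [NormedSpace ℝ E]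
    (M : Type*) [TopologicalSpace M] [ChartedSpace E M] : Type _ :=
  (x : M) → Submodule ℝ (TangentSpace 𝓘(ℝ, E) x)

/-- Fields of bilinear forms on the tangent spaces. -/
abbrev FormField (E : Type*) [NormedAddCommGroup E] [NormedSpace ℝ E]
    (M : Type*) [TopologicalSpace M] [ChartedSpace E M] : Type _ :=
  (x : M) → TangentSpace 𝓘(ℝ, E) x →ₗ[ℝ] TangentSpace 𝓘(ℝ, E) x →ₗ[ℝ] ℝ

/-- The Lie bracket `[X, Y]`. -/
abbrev bracket (X Y : VField E M) : VField E M :=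
  VectorField.mlieBracket 𝓘(ℝ, E) X Y

/-- The derivative `X(f)` of a function `f` along `X`, at `x`. -/
def derivAlong (X : VField E M) (f : M → ℝ) (x : M) : ℝ :=
  mfderiv 𝓘(ℝ, E) 𝓘(ℝ, ℝ) f x (X x)

variable [IsManifold 𝓘(ℝ, E) ∞ M]

/-- `Y` is a `C^∞` vector field on `U`. -/
def SmoothFieldOn (Y : VField E M) (U : Set M) : Prop :=
  ContMDiffOn 𝓘(ℝ, E) 𝓘(ℝ, E).tangent ∞ (fun x => (⟨x, Y x⟩ : TangentBundle 𝓘(ℝ, E) M)) U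

/-- `Y` is a smooth local section, on the open set `U`, of the field of planes `Δ`. -/
structure IsSection (Δ : PlaneField E M) (U : Set M) (Y : VField E M) : Prop where
  isOpen : IsOpen U
  smooth : SmoothFieldOn Y U
  mem : ∀ x ∈ U, Y x ∈ Δ x

/-- `e = (e₁, …, e_r)` is a smooth local frame, on the open set `U`, of `Δ`. -/
structure IsFrame (Δ : PlaneField E M) (U : Set M) {r : ℕ} (e : Fin r → VField E M) : Prop where
  isOpen : IsOpen U
  smooth : ∀ i, SmoothFieldOn (e i) U
  linearIndependent : ∀ x ∈ U, LinearIndependent ℝ (fun i => e i x)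
  span_eq : ∀ x ∈ U, Submodule.span ℝ (range fun i => e i x) = Δ x

/-- `Δ` is a smooth distribution of rank `r`. -/
def IsDistribution (Δ : PlaneField E M) (r : ℕ) : Prop :=
  ∀ x : M, ∃ (U : Set M) (e : Fin r → VField E M), x ∈ U ∧ IsFrame Δ U e

/-- The field of planes `Δ + [X, Δ]`, spanned by the local sections `Y` of `Δ` and by the
brackets `[X, Y]`. -/
def addBracket (X : VField E M) (Δ : PlaneField E M) : PlaneField E M := fun x =>
  Δ x ⊔ Submodule.span ℝ
    {w | ∃ (U : Set M) (Y : VField E M), x ∈ U ∧ IsSection Δ U Y ∧ w = bracket X Y x}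

/-- Regular semi-Hamiltonian quadruple `(X, V, D, σ)` with `rk V = m`. The form `σ` is a 2-form on
`D` only: nothing is required of `σ x v w`, and no use is made of it, unless `v, w ∈ D x`. -/
structure IsRegularSemiHamiltonian (m : ℕ) (X : VField E M) (V D : PlaneField E M)
    (σ : FormField E M) : Prop where
  smooth_field : SmoothFieldOn X univ
  distribution_V : IsDistribution V m
  distribution_D : IsDistribution D (2 * m)
  le : ∀ x, V x ≤ D x
  /-- `σ` is a smooth, skew-symmetric, non-degenerate form on `D`. -/
  smooth_form : ∀ (U : Set M) (Y Z : VField E M), IsSection D U Y → IsSection D U Z →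
    ContMDiffOn 𝓘(ℝ, E) 𝓘(ℝ, ℝ) ∞ (fun x => σ x (Y x) (Z x)) U
  skew : ∀ x, ∀ v ∈ D x, ∀ w ∈ D x, σ x v w = - σ x w v
  nondegenerate : ∀ x, ∀ v ∈ D x, (∀ w ∈ D x, σ x v w = 0) → v = 0
  /-- Condition (I): `[X, D] ⊆ D`. -/
  invariant : ∀ (U : Set M) (Y : VField E M), IsSection D U Y → ∀ x ∈ U, bracket X Y x ∈ D x
  /-- Condition (S): `σ` is invariant under the flow of `X`. -/
  invariant_form : ∀ (U : Set M) (Y Z : VField E M), IsSection D U Y → IsSection D U Z →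
    ∀ x ∈ U, derivAlong X (fun y => σ y (Y y) (Z y)) x =
      σ x (bracket X Y x) (Z x) + σ x (Y x) (bracket X Z x)
  /-- Condition (L): `V` is Lagrangian. -/
  lagrangian : ∀ x, ∀ v ∈ V x, ∀ w ∈ V x, σ x v w = 0
  /-- Condition (R1). -/
  ne_zero : ∀ x, X x ≠ 0
  /-- Condition (R2): `V + [X, V] = D`, which has the maximal possible rank `2m`. -/
  addBracket_eq : ∀ x, addBracket X V x = D x

/-! ### The canonical form -/

open Classical in
/-- A smooth local section of `Δ` near `x` with value `v` at `x` (zero if there is none). -/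
def extend (Δ : PlaneField E M) (x : M) (v : TangentSpace 𝓘(ℝ, E) x) : VField E M :=
  if h : ∃ Y : VField E M, Y x = v ∧ ∃ U : Set M, x ∈ U ∧ IsSection Δ U Y then h.choose else 0

/-- The canonical form `g(v, w) = σ([X, Y], w)` of a semi-Hamiltonian quadruple at `x`, for
`v, w ∈ V x`, where `Y` is a local section of `V` with `Y x = v`. -/
def canonicalForm (X : VField E M) (V : PlaneField E M) (σ : FormField E M) (x : M)
    (v w : TangentSpace 𝓘(ℝ, E) x) : ℝ :=
  σ x (bracket X (extend V x v) x) w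

/-- The canonical form is strictly definite, positive or negative, on `V x`. -/
def IsDefiniteAt (X : VField E M) (V : PlaneField E M) (σ : FormField E M) (x : M) : Prop :=
  (∀ v ∈ V x, v ≠ 0 → 0 < canonicalForm X V σ x v v) ∨
    (∀ v ∈ V x, v ≠ 0 → canonicalForm X V σ x v v < 0)

/-! ### The curvature operator -/

/-- The coefficients `c` in `v = ∑ i, c i • b i`; meaningful if `b` is linearly independent and
`v` lies in its span. -/
def coeffs {ι F : Type*} [Fintype ι] [AddCommGroup F] [Module ℝ F] (b : ι → F) (v : F) : ι → ℝ :=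
  Function.invFun (fun c : ι → ℝ => ∑ i, c i • b i) v

/-- The coefficients of `[X, [X, e j]]` with respect to `e₁, …, e_m, [X, e₁], …, [X, e_m]`. -/
def structureCoeffs (X : VField E M) {m : ℕ} (e : Fin m → VField E M) (y : M) (j : Fin m) :
    Fin m ⊕ Fin m → ℝ :=
  coeffs (Sum.elim (fun i => e i y) (fun i => bracket X (e i) y)) (bracket X (bracket X (e j)) y)

/-- The matrix `H₀` in `[X, [X, e]] = e H₀ + [X, e] H₁`. -/
def matrixH0 (X : VField E M) {m : ℕ} (e : Fin m → VField E M) (y : M) :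
    Matrix (Fin m) (Fin m) ℝ :=
  Matrix.of fun i j => structureCoeffs X e y j (Sum.inl i)

/-- The matrix `H₁` in `[X, [X, e]] = e H₀ + [X, e] H₁`. -/
def matrixH1 (X : VField E M) {m : ℕ} (e : Fin m → VField E M) (y : M) :
    Matrix (Fin m) (Fin m) ℝ :=
  Matrix.of fun i j => structureCoeffs X e y j (Sum.inr i)

/-- The curvature matrix `K = -H₀ + (1/2) X(H₁) - (1/4) H₁²` in the frame `e`. -/
def curvatureMatrix (X : VField E M) {m : ℕ} (e : Fin m → VField E M) (x : M) :
    Matrix (Fin m) (Fin m) ℝ :=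
  -matrixH0 X e x
    + (1 / 2 : ℝ) • Matrix.of (fun i j => derivAlong X (fun y => matrixH1 X e y i j) x)
    - (1 / 4 : ℝ) • (matrixH1 X e x * matrixH1 X e x)

open Classical in
/-- A smooth local frame of `Δ` near `x` (zero if there is none). -/
def localFrame (Δ : PlaneField E M) (m : ℕ) (x : M) : Fin m → VField E M :=
  if h : ∃ e : Fin m → VField E M, ∃ U : Set M, x ∈ U ∧ IsFrame Δ U e then h.choose else 0

/-- The curvature operator `K_x : V x → V x`, whose matrix in a local frame of `V` near `x` is
the curvature matrix in that frame. -/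
def curvature (m : ℕ) (X : VField E M) (V : PlaneField E M) (x : M)
    (v : TangentSpace 𝓘(ℝ, E) x) : TangentSpace 𝓘(ℝ, E) x :=
  let e := localFrame V m x
  ∑ i, (curvatureMatrix X e x).mulVec (coeffs (fun j => e j x) v) i • e i x

/-- The directional curvature `k(v) = g(K v, v) / g(v, v)`, for `v ∈ V x` with `g(v, v) ≠ 0`. -/
def directionalCurvature (m : ℕ) (X : VField E M) (V : PlaneField E M) (σ : FormField E M) (x : M)
    (v : TangentSpace 𝓘(ℝ, E) x) : ℝ :=
  canonicalForm X V σ x (curvature m X V x v) v / canonicalForm X V σ x v v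

/-! ### Conjugate times -/

open Classical in
/-- The flow map `exp(tX)`, `t ≥ 0`: it sends `y` to `γ t`, where `γ : [0, t] → M` is the integral
curve of `X` with `γ 0 = y` (and `y` to itself if the integral curve does not exist up to `t`). -/
def flow (X : VField E M) (t : ℝ) (y : M) : M :=
  if h : ∃ γ : ℝ → M, γ 0 = y ∧ IsMIntegralCurveOn γ X (Icc 0 t) then h.choose t else y

/-- `t > 0` is a conjugate time along the integral curve of `X` that starts at `x₀`:
`exp(tX)_* V(x₀) ∩ V(exp(tX) x₀) ≠ {0}`. -/
def IsConjugateTime (X : VField E M) (V : PlaneField E M) (x₀ : M) (t : ℝ) : Prop :=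
  0 < t ∧ (V x₀).map (mfderiv 𝓘(ℝ, E) 𝓘(ℝ, E) (flow X t) x₀).toLinearMap ⊓ V (flow X t x₀) ≠ ⊥

end DynamicPair

end

noncomputable section

namespace DynamicPair

/-! Let `v ≠ 0` lie in `V` at `c 0` and let `J` be its transport by the flow. Invariance of `D`
under `X` keeps `J` in `D`. In a local frame `e` of `V`, regularity makes `e, [X, e]` a frame of
`D`; writing `J = e a + [X, e] b`, invariance of `J` under the flow becomes `a' = -H₀ b`, `b' = -a -
H₁ b`. The vector `u = e b` represents the class of `J` in `D / V`, so a conjugate time forces `u =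
0` for some such `v`.

For the covariant derivative `∇ = d/ds + H₁ / 2` the canonical form `g` is parallel, and the system
is the Jacobi equation `∇∇b = -K b`. With `w = ∇b`, `q = g(b, b)` and `p = g(b, w)`, one gets `q' =
2 p` and `p' = g(w, w) - g(K b, b)`. The Cauchy–Schwarz inequality and the curvature bound give `p²
≤ q p' + λ q²`, which is `f'' ≥ -λ f` for `f = √q` where `q > 0`. Moreover `q` has a double zero at
`0` with `q''(0) = 2 g(w, w) ≠ 0`. Comparison with a sine shows that `q` cannot vanish again before
time `π / μ` if `μ² ≥ λ`. The inequality is unchanged under `q ↦ -q`, so both signs of `g` are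
covered.

The scalar part is `ne_zero_of_sturm`; the coordinates come from `exists_transport_coords`, resting
on the differentiability of the flow (`flowRegularAt`, `variational_equation`); the derivatives of
`q` and `p` are in `hasDerivWithinAt_gram`; `transport_notMem` combines them. -/

/-- A property that propagates forward locally near every point of `[0, t]` and holds at `0`
holds on all of `[0, t]`. -/
theorem forall_Icc_of_locally_propagates {t : ℝ} {P : ℝ → Prop} (h0 : P 0)
    (hP : ∀ s₀ ∈ Icc 0 t, ∃ δ > 0, ∀ s₁ ∈ Icc 0 t, ∀ s ∈ Icc 0 t, s₀ - δ < s₁ → s₁ ≤ s →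
      s < s₀ + δ → s₁ ≤ s₀ → P s₁ → P s) : ∀ s ∈ Icc 0 t, P s := by
  intro s hs
  by_contra hns
  set S := {r ∈ Icc 0 t | ¬ P r} with hS
  have hbdd : BddBelow S := ⟨0, fun r hr => hr.1.1⟩
  have hne : S.Nonempty := ⟨s, hs, hns⟩
  set s₀ := sInf S
  have hs₀ : s₀ ∈ Icc 0 t :=
    ⟨le_csInf hne fun r hr => hr.1.1, (csInf_le hbdd ⟨hs, hns⟩).trans hs.2⟩
  obtain ⟨δ, hδ, h⟩ := hP s₀ hs₀
  obtain ⟨r, hr, hrδ⟩ := exists_lt_of_csInf_lt hne (show sInf S < s₀ + δ by linarith)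
  have hs₀r : s₀ ≤ r := csInf_le hbdd hr
  refine hr.2 ?_
  -- If the infimum of the failure set is `0`, propagation starts from the given `P 0`; otherwise it
  -- starts from a point slightly below the infimum, where `P` holds.
  rcases eq_or_lt_of_le hs₀.1 with h00 | h00
  · exact h 0 ⟨le_rfl, hs₀.1.trans hs₀.2⟩ r hr.1 (by linarith) hr.1.1 hrδ hs₀.1 h0
  · set s₁ := max 0 (s₀ - δ / 2)
    have hs₁ : s₁ < s₀ := max_lt h00 (by linarith)
    have h1 : s₁ ∈ Icc 0 t := ⟨le_max_left _ _, hs₁.le.trans hs₀.2⟩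
    refine h s₁ h1 r hr.1 ?_ (hs₁.le.trans hs₀r) hrδ hs₁.le ?_
    · exact lt_of_lt_of_le (by linarith) (le_max_right _ _)
    · by_contra hc
      exact absurd (csInf_le hbdd (show s₁ ∈ S from ⟨h1, hc⟩)) (not_le.2 hs₁)

/-! ### Scalar Sturm comparison -/

/-- Sturm comparison for a positive function: if `q > 0` on `[δ, t)` satisfies
`p² ≤ q p' + μ² q²`, where `q' = 2 p`, and `p / q` exceeds the solution `μ cot (μ (s + ε))` of the
Riccati equation at `δ`, then `q` does not vanish at `t`. -/
theorem pos_of_riccati_comparison {q p d : ℝ → ℝ} {δ t μ ε : ℝ} (hδ : 0 < δ) (hδt : δ < t) (hμ : 0 < μ)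
    (hε : 0 < ε) (hεt : μ * (t + ε) < Real.pi) (hqc : ContinuousOn q (Icc δ t))
    (hq : ∀ s ∈ Ioo δ t, HasDerivAt q (2 * p s) s) (hpc : ContinuousOn p (Icc δ t))
    (hp : ∀ s ∈ Ioo δ t, HasDerivAt p (d s) s)
    (hpos : ∀ s ∈ Ico δ t, 0 < q s)
    (hineq : ∀ s ∈ Ioo δ t, p s ^ 2 ≤ q s * d s + μ ^ 2 * q s ^ 2)
    (hinit : μ * q δ * Real.cos (μ * (δ + ε)) ≤ p δ * Real.sin (μ * (δ + ε))) : 0 < q t := by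
  set S : ℝ → ℝ := fun s => Real.sin (μ * (s + ε)) with hS
  set C : ℝ → ℝ := fun s => Real.cos (μ * (s + ε)) with hC
  have hSd : ∀ s, HasDerivAt S (μ * C s) s := fun s => by
    have := (((hasDerivAt_id s).add_const ε).const_mul μ).sin
    simpa [hS, hC, mul_comm] using this
  have hCd : ∀ s, HasDerivAt C (-(μ * S s)) s := fun s => by
    have := (((hasDerivAt_id s).add_const ε).const_mul μ).cos
    simpa [hS, hC, mul_comm] using this
  have hSpos : ∀ s ∈ Icc δ t, 0 < S s := fun s hs => by
    refine Real.sin_pos_of_pos_of_lt_pi (by have := hs.1; exact mul_pos hμ (by linarith))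
      (lt_of_le_of_lt ?_ hεt)
    exact mul_le_mul_of_nonneg_left (by linarith [hs.2]) hμ.le
  -- `Ψ = √q (p / q * S - μ C)` is nondecreasing
  set Ψ : ℝ → ℝ := fun s => (p s * S s - μ * (q s * C s)) / √(q s) with hΨ
  have hIcc : ∀ s ∈ Ico δ t, Icc δ s ⊆ Icc δ t := fun s hs => Icc_subset_Icc le_rfl hs.2.le
  have hΨd : ∀ s ∈ Ioo δ t, HasDerivAt Ψ
      (((d s * S s + p s * (μ * C s) - μ * (2 * p s * C s + q s * (-(μ * S s)))) * √(q s) -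
        (p s * S s - μ * (q s * C s)) * (2 * p s / (2 * √(q s)))) / √(q s) ^ 2) s := by
    intro s hs
    have hq0 := hpos s ⟨hs.1.le, hs.2⟩
    exact ((((hp s hs).mul (hSd s)).sub (((hq s hs).mul (hCd s)).const_mul μ))).div
      ((hq s hs).sqrt hq0.ne') (Real.sqrt_pos.2 hq0).ne'
  have hΨnn : ∀ s ∈ Ico δ t, 0 ≤ Ψ s := by
    intro s hs
    have hmono : MonotoneOn Ψ (Icc δ s) := by
      refine monotoneOn_of_deriv_nonneg (convex_Icc _ _) ?_ ?_ ?_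
      · refine ContinuousOn.div ?_ ?_ ?_
        · have hSc : Continuous S := continuous_iff_continuousAt.2 fun s => (hSd s).continuousAt
          have hCc : Continuous C := continuous_iff_continuousAt.2 fun s => (hCd s).continuousAt
          exact (((hpc.mono (hIcc s hs)).mul hSc.continuousOn)).sub
            (continuousOn_const.mul ((hqc.mono (hIcc s hs)).mul hCc.continuousOn))
        · exact (hqc.mono (hIcc s hs)).sqrt
        · exact fun r hr => (Real.sqrt_pos.2 (hpos r ⟨hr.1, hr.2.trans_lt hs.2⟩)).ne'
      · rw [interior_Icc]
        exact fun r hr => (hΨd r ⟨hr.1, hr.2.trans hs.2⟩).differentiableAt.differentiableWithinAt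
      · rw [interior_Icc]
        intro r hr
        have hr' : r ∈ Ioo δ t := ⟨hr.1, hr.2.trans hs.2⟩
        have hq0 := hpos r ⟨hr.1.le, hr'.2⟩
        rw [(hΨd r hr').deriv]
        refine div_nonneg ?_ (sq_nonneg _)
        have hsq := Real.sq_sqrt hq0.le
        have hs0 := Real.sqrt_pos.2 hq0
        have hS0 := hSpos r ⟨hr.1.le, hr'.2.le⟩
        have hi := hineq r hr'
        -- With `f = √q`, `Ψ = f' S - f S'` is a Wronskian and `Ψ' = (f'' + μ² f) S`, where `f'' =
        -- (q d - p²) / q^(3/2)`. The assumed inequality says exactly that `f'' + μ² f ≥ 0`.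
        have key : (d r * S r + p r * (μ * C r) - μ * (2 * p r * C r + q r * (-(μ * S r)))) *
            √(q r) - (p r * S r - μ * (q r * C r)) * (2 * p r / (2 * √(q r))) =
            (q r * d r + μ ^ 2 * q r ^ 2 - p r ^ 2) * S r / √(q r) := by
          field_simp
          rw [hsq]
          ring
        rw [key]
        exact div_nonneg (mul_nonneg (by linarith) hS0.le) hs0.le
    have h1 := hmono (left_mem_Icc.2 hs.1) (right_mem_Icc.2 hs.1) hs.1
    refine le_trans ?_ h1
    refine div_nonneg ?_ (Real.sqrt_nonneg _)
    simp only [hS, hC]; nlinarith [hinit]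
  -- `q / S²` is nondecreasing
  have hmono : MonotoneOn (fun s => q s / S s ^ 2) (Icc δ t) := by
    have hder : ∀ s ∈ Ioo δ t, HasDerivAt (fun s => q s / S s ^ 2)
        ((2 * p s * S s ^ 2 - q s * (2 * S s * (μ * C s))) / (S s ^ 2) ^ 2) s := by
      intro s hs
      have := (hq s hs).div ((hSd s).pow 2) (pow_pos (hSpos s ⟨hs.1.le, hs.2.le⟩) 2).ne'
      simp only [Nat.cast_ofNat, Nat.add_one_sub_one, pow_one] at this
      exact this
    refine monotoneOn_of_deriv_nonneg (convex_Icc _ _) ?_ ?_ ?_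
    · have hSc : Continuous S := continuous_iff_continuousAt.2 fun s => (hSd s).continuousAt
      exact hqc.div (hSc.pow 2).continuousOn fun s hs => (pow_pos (hSpos s hs) 2).ne'
    · rw [interior_Icc]
      exact fun r hr => (hder r hr).differentiableAt.differentiableWithinAt
    · rw [interior_Icc]
      intro r hr
      rw [(hder r hr).deriv]
      refine div_nonneg ?_ (sq_nonneg _)
      have h1 := hΨnn r ⟨hr.1.le, hr.2⟩
      have hq0 := hpos r ⟨hr.1.le, hr.2⟩
      -- The numerator of the derivative of `q / S²` is `2 S (p S - μ q C)`, and the bracket equals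
      -- `√q Ψ`.
      have h2 : 0 ≤ p r * S r - μ * (q r * C r) := by
        have := mul_nonneg h1 (Real.sqrt_nonneg (q r))
        rwa [hΨ, div_mul_cancel₀ _ (Real.sqrt_pos.2 hq0).ne'] at this
      have := mul_nonneg h2 (hSpos r ⟨hr.1.le, hr.2.le⟩).le
      nlinarith
  have h1 := hmono (left_mem_Icc.2 hδt.le) (right_mem_Icc.2 hδt.le) hδt.le
  have h2 : 0 < q δ / S δ ^ 2 :=
    div_pos (hpos δ ⟨le_rfl, hδt⟩) (pow_pos (hSpos δ (left_mem_Icc.2 hδt.le)) 2)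
  have h3 := h2.trans_le h1
  by_contra hc
  exact absurd h3 (not_lt.2 (div_nonpos_of_nonpos_of_nonneg (not_lt.1 hc) (sq_nonneg _)))

/-- Sturm comparison near a double zero at `0`, with a global second derivative. -/
theorem ne_zero_of_sturm_of_pos {q p d : ℝ → ℝ} {t μ : ℝ} (ht : 0 < t) (hμ : 0 < μ)
    (hμt : μ * t < Real.pi)
    (hq : ∀ s ∈ Icc 0 t, HasDerivWithinAt q (2 * p s) (Icc 0 t) s)
    (hp : ∀ s ∈ Icc 0 t, HasDerivWithinAt p (d s) (Icc 0 t) s)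
    (hineq : ∀ s ∈ Icc 0 t, p s ^ 2 ≤ q s * d s + μ ^ 2 * q s ^ 2)
    (hq0 : q 0 = 0) (hp0 : p 0 = 0) (hd0 : 0 < d 0) : q t ≠ 0 := by
  intro hqt
  have hqc : ContinuousOn q (Icc 0 t) := fun s hs => (hq s hs).continuousWithinAt
  have hpc : ContinuousOn p (Icc 0 t) := fun s hs => (hp s hs).continuousWithinAt
  have hqd : ∀ s ∈ Ioo 0 t, HasDerivAt q (2 * p s) s := fun s hs =>
    (hq s ⟨hs.1.le, hs.2.le⟩).hasDerivAt (Icc_mem_nhds hs.1 hs.2)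
  have hpd : ∀ s ∈ Ioo 0 t, HasDerivAt p (d s) s := fun s hs =>
    (hp s ⟨hs.1.le, hs.2.le⟩).hasDerivAt (Icc_mem_nhds hs.1 hs.2)
  -- Linear bounds on `p` come from `p 0 = 0` and `p' 0 = d 0 > 0`; integrating `q' = 2 p` turns
  -- them into the quadratic bounds `hlow` and `hup`.
  obtain ⟨η, hη, hηt, hpη⟩ : ∃ η > 0, η < t ∧ ∀ s ∈ Icc 0 η,
      d 0 / 2 * s ≤ p s ∧ p s ≤ 2 * d 0 * s := by
    have h0 := (hp 0 (left_mem_Icc.2 ht.le)).hasFDerivWithinAt.isLittleO.def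
      (show 0 < d 0 / 2 by positivity)
    obtain ⟨η, hη, h⟩ := Metric.mem_nhdsWithin_iff.1 h0
    refine ⟨min (η / 2) (t / 2), by positivity, (min_le_right _ _).trans_lt (by linarith), ?_⟩
    intro s hs
    have h1 : s ≤ η / 2 := hs.2.trans (min_le_left _ _)
    have h2 : s ≤ t / 2 := hs.2.trans (min_le_right _ _)
    have h3 := h ⟨by rw [Metric.mem_ball, Real.dist_eq, sub_zero, abs_of_nonneg hs.1]; linarith,
      hs.1, by linarith⟩
    simp only [mem_ofPred_eq, hp0, sub_zero, Real.norm_eq_abs, abs_of_nonneg hs.1,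
      ContinuousLinearMap.toSpanSingleton_apply, smul_eq_mul] at h3
    have h4 := abs_le.1 h3
    constructor <;> nlinarith [h4.1, h4.2, hs.1]
  have hsub : Icc 0 η ⊆ Icc 0 t := Icc_subset_Icc le_rfl hηt.le
  have hlow : ∀ s ∈ Icc 0 η, d 0 / 2 * s ^ 2 ≤ q s := by
    have hm : MonotoneOn (fun s => q s - d 0 / 2 * s ^ 2) (Icc 0 η) := by
      have hd : ∀ s ∈ Ioo 0 η, HasDerivAt (fun s => q s - d 0 / 2 * s ^ 2)
          (2 * p s - d 0 / 2 * (2 * s)) s := fun s hs => by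
        have := (hqd s ⟨hs.1, hs.2.trans hηt⟩).fun_sub
          (((hasDerivAt_id s).pow 2).const_mul (d 0 / 2))
        simpa using this
      refine monotoneOn_of_deriv_nonneg (convex_Icc _ _) ?_ ?_ ?_
      · exact (hqc.mono hsub).sub (by fun_prop)
      · rw [interior_Icc]
        exact fun s hs => (hd s hs).differentiableAt.differentiableWithinAt
      · rw [interior_Icc]
        intro s hs
        rw [(hd s hs).deriv]
        nlinarith [(hpη s ⟨hs.1.le, hs.2.le⟩).1]
    intro s hs
    have := hm (left_mem_Icc.2 hη.le) hs hs.1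
    simp only [hq0] at this
    linarith
  have hup : ∀ s ∈ Icc 0 η, q s ≤ 2 * d 0 * s ^ 2 := by
    have hm : MonotoneOn (fun s => 2 * d 0 * s ^ 2 - q s) (Icc 0 η) := by
      have hd : ∀ s ∈ Ioo 0 η, HasDerivAt (fun s => 2 * d 0 * s ^ 2 - q s)
          (2 * d 0 * (2 * s) - 2 * p s) s := fun s hs => by
        have := (((hasDerivAt_id s).pow 2).const_mul (2 * d 0)).fun_sub
          (hqd s ⟨hs.1, hs.2.trans hηt⟩)
        simpa using this
      refine monotoneOn_of_deriv_nonneg (convex_Icc _ _) ?_ ?_ ?_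
      · exact ContinuousOn.sub (by fun_prop) (hqc.mono hsub)
      · rw [interior_Icc]
        exact fun s hs => (hd s hs).differentiableAt.differentiableWithinAt
      · rw [interior_Icc]
        intro s hs
        rw [(hd s hs).deriv]
        nlinarith [(hpη s ⟨hs.1.le, hs.2.le⟩).2]
    intro s hs
    have := hm (left_mem_Icc.2 hη.le) hs hs.1
    simp only [hq0] at this
    linarith
  have hposη : ∀ s ∈ Ioc 0 η, 0 < q s := fun s hs =>
    lt_of_lt_of_le (by have := hs.1; positivity) (hlow s ⟨hs.1.le, hs.2⟩)
  -- the first zero of `q` after `η`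
  obtain ⟨z, ⟨hz, hqz⟩, hzmin⟩ : ∃ z, (z ∈ Icc η t ∧ q z = 0) ∧
      ∀ s ∈ Icc η t, q s = 0 → z ≤ s := by
    have hcomp : IsCompact (Icc η t ∩ q ⁻¹' {0}) := by
      have hcl : IsClosed (Icc η t ∩ q ⁻¹' {0}) :=
        (hqc.mono (Icc_subset_Icc hη.le le_rfl)).preimage_isClosed_of_isClosed isClosed_Icc
          isClosed_singleton
      exact isCompact_Icc.of_isClosed_subset hcl inter_subset_left
    obtain ⟨z, hz, hmin⟩ := hcomp.exists_isLeast ⟨t, ⟨hηt.le, le_rfl⟩, hqt⟩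
    exact ⟨z, hz, fun s hs h => hmin ⟨hs, h⟩⟩
  have hηz : η < z := lt_of_le_of_ne hz.1 fun h => by
    have := hposη η ⟨hη, le_rfl⟩
    rw [h, hqz] at this
    exact lt_irrefl _ this
  have hpos : ∀ s ∈ Ioo 0 z, 0 < q s := by
    intro s hs
    rcases le_total s η with h | h
    · exact hposη s ⟨hs.1, h⟩
    · by_contra hc
      obtain ⟨r, hr, hr0⟩ := intermediate_value_Icc' h
        (hqc.mono (Icc_subset_Icc hη.le (hs.2.le.trans hz.2)))
        ⟨not_lt.1 hc, (hposη η ⟨hη, le_rfl⟩).le⟩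
      have := hzmin r ⟨hr.1, hr.2.trans (hs.2.le.trans hz.2)⟩ hr0
      linarith [hr.2, hs.2]
  -- The shift `ε` makes the comparison at `δ` strict: `p / q` and `μ cot (μ s)` both behave like `1
  -- / s` at `0`, whereas `μ cot (μ (s + ε))` stays bounded there.
  obtain ⟨ε, hε, hεt⟩ : ∃ ε > 0, μ * (t + ε) < Real.pi := by
    refine ⟨(Real.pi - μ * t) / (2 * μ), div_pos (by linarith) (by positivity), ?_⟩
    rw [mul_add]
    have : μ * ((Real.pi - μ * t) / (2 * μ)) = (Real.pi - μ * t) / 2 := by field_simp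
    rw [this]; linarith
  -- The bounds on `p` and `q` give `p / q ≥ 1 / (4 δ)` at `δ`; this explains the constant `4 μ δ`.
  obtain ⟨δ, hδ, hδη, hinit⟩ : ∃ δ > 0, δ < η ∧ 4 * μ * δ ≤ Real.sin (μ * (δ + ε)) := by
    have hc : ContinuousAt (fun δ => Real.sin (μ * (δ + ε)) - 4 * μ * δ) 0 := by fun_prop
    have h0 : 0 < Real.sin (μ * (0 + ε)) - 4 * μ * 0 := by
      simp only [zero_add, mul_zero, sub_zero]
      exact Real.sin_pos_of_pos_of_lt_pi (by positivity)
        ((mul_le_mul_of_nonneg_left (by linarith) hμ.le).trans_lt hεt)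
    have h1 := (hc.eventually (lt_mem_nhds h0)).filter_mono (nhdsWithin_le_nhds (s := Ioi 0))
    obtain ⟨δ, hδ, hδη⟩ := (h1.and (Ioo_mem_nhdsGT hη)).exists
    exact ⟨δ, hδη.1, hδη.2, by linarith⟩
  have hδz : δ < z := hδη.trans hηz
  have hsub' : Icc δ z ⊆ Icc 0 t := Icc_subset_Icc hδ.le hz.2
  have hsub'' : Ioo δ z ⊆ Ioo 0 t := Ioo_subset_Ioo hδ.le hz.2
  refine (pos_of_riccati_comparison (d := d) hδ hδz hμ hε ?_ (hqc.mono hsub')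
    (fun s hs => hqd s (hsub'' hs)) (hpc.mono hsub') (fun s hs => hpd s (hsub'' hs))
    (fun s hs => hpos s ⟨hδ.trans_le hs.1, hs.2⟩)
    (fun s hs => hineq s (hsub' ⟨hs.1.le, hs.2.le⟩)) ?_).ne' hqz
  · exact (mul_le_mul_of_nonneg_left (by linarith [hz.2]) hμ.le).trans_lt hεt
  · have hδ' : δ ∈ Icc 0 η := ⟨hδ.le, hδη.le⟩
    have h1 := (hpη δ hδ').1
    have h2 := hup δ hδ'
    have h3 := hposη δ ⟨hδ, hδη.le⟩
    calc μ * q δ * Real.cos (μ * (δ + ε)) ≤ μ * q δ * 1 :=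
          mul_le_mul_of_nonneg_left (Real.cos_le_one _) (by positivity)
      _ ≤ μ * (2 * d 0 * δ ^ 2) := by rw [mul_one]; exact mul_le_mul_of_nonneg_left h2 hμ.le
      _ = d 0 / 2 * δ * (4 * μ * δ) := by ring
      _ ≤ d 0 / 2 * δ * Real.sin (μ * (δ + ε)) := mul_le_mul_of_nonneg_left hinit (by positivity)
      _ ≤ p δ * Real.sin (μ * (δ + ε)) :=
          mul_le_mul_of_nonneg_right h1 (le_trans (by positivity) hinit)

/-- Sturm comparison: let `q` be twice differentiable on `[0, t]`, with a double zero at `0` and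
`q'' 0 ≠ 0`. If `p² ≤ q p' + λ q²`, where `q' = 2 p`, then `q t ≠ 0` provided that
`λ ≤ μ²` and `μ t < π`. The hypotheses do not change if `q` is replaced by `-q`. -/
theorem ne_zero_of_sturm {q : ℝ → ℝ} {t lam μ : ℝ} (ht : 0 < t) (hμ : 0 < μ)
    (hμt : μ * t < Real.pi) (hlam : lam ≤ μ ^ 2)
    (h : ∀ s₀ ∈ Icc 0 t, ∃ (p : ℝ → ℝ) (d : ℝ),
      (∀ᶠ s in 𝓝[Icc 0 t] s₀, HasDerivWithinAt q (2 * p s) (Icc 0 t) s) ∧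
      HasDerivWithinAt p d (Icc 0 t) s₀ ∧ p s₀ ^ 2 ≤ q s₀ * d + lam * q s₀ ^ 2 ∧
      (s₀ = 0 → q 0 = 0 ∧ p 0 = 0 ∧ d ≠ 0)) : q t ≠ 0 := by
  choose! P d hPq hPd hineq hzero using h
  -- The hypothesis supplies a different `p` near each time. They glue, since each is half the
  -- derivative of `q` within the interval, and that derivative is unique.
  set p : ℝ → ℝ := fun s => derivWithin q (Icc 0 t) s / 2 with hp
  have huniq := uniqueDiffOn_Icc ht
  have hpP : ∀ s₀ ∈ Icc 0 t, ∀ᶠ s in 𝓝[Icc 0 t] s₀, p s = P s₀ s := fun s₀ hs₀ => by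
    filter_upwards [hPq s₀ hs₀, self_mem_nhdsWithin] with s hs hs'
    simp [hp, hs.derivWithin (huniq s hs')]
  have hpP' : ∀ s ∈ Icc 0 t, p s = P s s := fun s hs => (hpP s hs).self_of_nhdsWithin hs
  have hq : ∀ s ∈ Icc 0 t, HasDerivWithinAt q (2 * p s) (Icc 0 t) s := fun s hs => by
    rw [hpP' s hs]; exact (hPq s hs).self_of_nhdsWithin hs
  have hpd : ∀ s ∈ Icc 0 t, HasDerivWithinAt p (d s) (Icc 0 t) s := fun s hs =>
    (hPd s hs).congr_of_eventuallyEq (hpP s hs) (hpP' s hs)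
  have hi : ∀ s ∈ Icc 0 t, p s ^ 2 ≤ q s * d s + μ ^ 2 * q s ^ 2 := fun s hs => by
    rw [hpP' s hs]
    nlinarith [hineq s hs, mul_le_mul_of_nonneg_right hlam (sq_nonneg (q s))]
  have h0 : (0 : ℝ) ∈ Icc 0 t := left_mem_Icc.2 ht.le
  obtain ⟨hq0, hp0, hd0⟩ := hzero 0 h0 rfl
  rw [← hpP' 0 h0] at hp0
  rcases lt_or_gt_of_ne hd0 with hneg | hpos
  · have := ne_zero_of_sturm_of_pos (q := fun s => -q s) (p := fun s => -p s) (d := fun s => -d s)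
      ht hμ hμt (fun s hs => by simpa using (hq s hs).fun_neg) (fun s hs => (hpd s hs).neg)
      (fun s hs => by simpa using hi s hs) (by simp [hq0]) (by simp [hp0]) (by simpa using hneg)
    simpa using this
  · exact ne_zero_of_sturm_of_pos ht hμ hμt hq hpd hi hq0 hp0 hpos

/-! ### Differentiable dependence on initial data in a normed space -/

section Flow

variable {E : Type*} [NormedAddCommGroup E] [NormedSpace ℝ E]

/-- First-order Taylor estimate for a map whose derivative is Lipschitz on a convex set. -/
theorem norm_image_sub_sub_le_of_lipschitz_fderiv {F : Type*} [NormedAddCommGroup F]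
    [NormedSpace ℝ F] {f : E → F} {s : Set E} {K : NNReal} (hs : Convex ℝ s)
    (hf : ∀ z ∈ s, DifferentiableAt ℝ f z) (hK : LipschitzOnWith K (fderiv ℝ f) s) {x y : E}
    (hx : x ∈ s) (hy : y ∈ s) : ‖f y - f x - fderiv ℝ f x (y - x)‖ ≤ K * ‖y - x‖ ^ 2 := by
  have hseg : segment ℝ x y ⊆ s := hs.segment_subset hx hy
  have := (convex_segment x y).norm_image_sub_le_of_norm_hasFDerivWithin_le' (f := f)
    (f' := fderiv ℝ f) (φ := fderiv ℝ f x) (C := K * ‖y - x‖) (x := x) (y := y)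
    (fun z hz => (hf z (hseg hz)).hasFDerivAt.hasFDerivWithinAt) ?_
    (left_mem_segment ℝ x y) (right_mem_segment ℝ x y)
  · calc _ ≤ K * ‖y - x‖ * ‖y - x‖ := this
      _ = _ := by ring
  · intro z hz
    refine (hK.norm_sub_le (hseg hz) hx).trans ?_
    refine mul_le_mul_of_nonneg_left ?_ K.2
    obtain ⟨θ, hθ, rfl⟩ := (segment_eq_image' ℝ x y ▸ hz : z ∈ (fun θ : ℝ => x + θ • (y - x)) '' Icc 0 1)
    rw [add_sub_cancel_left, norm_smul, Real.norm_eq_abs, abs_of_nonneg hθ.1]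
    exact mul_le_of_le_one_left (norm_nonneg _) hθ.2

/-- The derivative of a flow with respect to the initial point is the solution of the linearized
equation. -/
theorem hasFDerivAt_flow {f : E → E} {s : Set E} {K M K' : NNReal} (hs : Convex ℝ s)
    (hf : ∀ z ∈ s, DifferentiableAt ℝ f z) (hK : LipschitzOnWith K (fderiv ℝ f) s)
    (hM : ∀ z ∈ s, ‖fderiv ℝ f z‖ ≤ M) {ε : ℝ} {Φ : E → ℝ → E} {L : ℝ → E →L[ℝ] E} {z : E}
    {O : Set E} (hO : O ∈ 𝓝 z) (h0 : ∀ y ∈ O, Φ y 0 = y)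
    (hmem : ∀ y ∈ O, ∀ τ ∈ Icc 0 ε, Φ y τ ∈ s)
    (hΦ : ∀ y ∈ O, ∀ τ ∈ Icc 0 ε, HasDerivWithinAt (Φ y) (f (Φ y τ)) (Icc 0 ε) τ)
    (hΦL : ∀ τ ∈ Icc 0 ε, LipschitzOnWith K' (Φ · τ) O)
    (hL0 : L 0 = ContinuousLinearMap.id ℝ E)
    (hL : ∀ τ ∈ Icc 0 ε, HasDerivWithinAt L (fderiv ℝ f (Φ z τ) ∘L L τ) (Icc 0 ε) τ) :
    ∀ τ ∈ Icc 0 ε, HasFDerivAt (Φ · τ) (L τ) z := by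
  intro τ hτ
  have hz : z ∈ O := mem_of_mem_nhds hO
  set C : ℝ := gronwallBound 0 M (K * K' ^ 2) τ
  -- The error `u` vanishes at time `0` and satisfies `‖u'‖ ≤ M ‖u‖ + K K'² ‖y - z‖²`, the last term
  -- being the Taylor remainder along two trajectories at distance at most `K' ‖y - z‖`. Grönwall's
  -- inequality then gives a quadratic bound.
  have key : ∀ y ∈ O, ‖Φ y τ - Φ z τ - L τ (y - z)‖ ≤ C * ‖y - z‖ ^ 2 := by
    intro y hy
    set u : ℝ → E := fun r => Φ y r - Φ z r - L r (y - z) with hu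
    have hud : ∀ r ∈ Icc 0 ε, HasDerivWithinAt u
        (f (Φ y r) - f (Φ z r) - fderiv ℝ f (Φ z r) (L r (y - z))) (Icc 0 ε) r := by
      intro r hr
      have h1 : HasDerivWithinAt (fun r => L r (y - z)) (fderiv ℝ f (Φ z r) (L r (y - z)))
          (Icc 0 ε) r := by
        simpa using (hL r hr).clm_apply (hasDerivWithinAt_const r (Icc 0 ε) (y - z))
      exact ((hΦ y hy r hr).fun_sub (hΦ z hz r hr)).fun_sub h1
    have hbound : ∀ r ∈ Icc 0 ε, ‖f (Φ y r) - f (Φ z r) - fderiv ℝ f (Φ z r) (L r (y - z))‖ ≤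
        M * ‖u r‖ + K * K' ^ 2 * ‖y - z‖ ^ 2 := by
      intro r hr
      have h1 : f (Φ y r) - f (Φ z r) - fderiv ℝ f (Φ z r) (L r (y - z)) =
          fderiv ℝ f (Φ z r) (u r) +
            (f (Φ y r) - f (Φ z r) - fderiv ℝ f (Φ z r) (Φ y r - Φ z r)) := by
        simp only [hu, map_sub]; abel
      rw [h1]
      refine (norm_add_le _ _).trans (add_le_add ?_ ?_)
      · exact (ContinuousLinearMap.le_opNorm _ _).trans
          (mul_le_mul_of_nonneg_right (hM _ (hmem z hz r hr)) (norm_nonneg _))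
      · refine (norm_image_sub_sub_le_of_lipschitz_fderiv hs hf hK (hmem z hz r hr)
          (hmem y hy r hr)).trans ?_
        have h2 := (hΦL r hr).norm_sub_le hy hz
        have h3 : ‖Φ y r - Φ z r‖ ^ 2 ≤ (K' * ‖y - z‖) ^ 2 :=
          pow_le_pow_left₀ (norm_nonneg _) h2 2
        calc K * ‖Φ y r - Φ z r‖ ^ 2 ≤ K * (K' * ‖y - z‖) ^ 2 :=
              mul_le_mul_of_nonneg_left h3 K.2
          _ = _ := by ring
    have hg := norm_le_gronwallBound_of_norm_deriv_right_le (f := u) (δ := 0) (a := 0) (b := ε)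
      (K := M) (ε := K * K' ^ 2 * ‖y - z‖ ^ 2)
      (fun r hr => (hud r hr).continuousWithinAt)
      (fun r hr => ((hud r ⟨hr.1, hr.2.le⟩).mono_of_mem_nhdsWithin (Icc_mem_nhdsGE_of_mem hr)))
      (by simp [hu, h0 y hy, h0 z hz, hL0]) (fun r hr => hbound r ⟨hr.1, hr.2.le⟩) τ hτ
    rw [sub_zero] at hg
    refine hg.trans (le_of_eq ?_)
    simp only [C]
    by_cases hM0 : (M : ℝ) = 0
    · simp only [hM0, gronwallBound_K0, zero_add]; ring
    · simp only [gronwallBound_of_K_ne_0 hM0]; ring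
  refine .of_isLittleO ?_
  have hO' : (fun y => Φ y τ - Φ z τ - L τ (y - z)) =O[𝓝 z] fun y => ‖y - z‖ ^ 2 :=
    Asymptotics.IsBigO.of_bound C (by
      filter_upwards [hO] with y hy
      simpa using key y hy)
  refine hO'.trans_isLittleO ?_
  have h1 : (fun y : E => ‖y - z‖ ^ 2) =o[𝓝 z] fun y => ‖y - z‖ ^ 1 :=
    (Asymptotics.isLittleO_pow_pow one_lt_two).comp_tendsto (k := fun y : E => ‖y - z‖)
      (tendsto_norm_sub_self z)
  simpa using h1

/-- Local flow of a `C²` vector field, with its derivative in the initial point. -/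
theorem exists_local_flow [CompleteSpace E] {f : E → E} {z₀ : E} (hf : ContDiffAt ℝ 2 f z₀)
    {N : Set E} (hN : N ∈ 𝓝 z₀) :
    ∃ ε > 0, ∃ O ∈ 𝓝 z₀, ∃ (Φ : E → ℝ → E) (L : E → ℝ → E →L[ℝ] E), IsOpen O ∧ ∀ z ∈ O,
      Φ z 0 = z ∧ ∀ τ ∈ Icc 0 ε, Φ z τ ∈ N ∧
        HasDerivWithinAt (Φ z) (f (Φ z τ)) (Icc 0 ε) τ ∧
        HasDerivWithinAt (L z) (fderiv ℝ f (Φ z τ) ∘L L z τ) (Icc 0 ε) τ ∧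
        HasFDerivAt (Φ · τ) (L z τ) z := by
  have hDf : ContDiffAt ℝ 1 (fderiv ℝ f) z₀ := hf.fderiv_right (by norm_num)
  obtain ⟨K, s₁, hs₁, hK⟩ := hDf.exists_lipschitzOnWith
  have hdiff : ∀ᶠ z in 𝓝 z₀, DifferentiableAt ℝ f z := by
    filter_upwards [hf.eventually (by simp)] with z hz
    exact hz.differentiableAt (by norm_num)
  have hbdd : ∀ᶠ z in 𝓝 z₀, ‖fderiv ℝ f z‖ < ‖fderiv ℝ f z₀‖ + 1 :=
    hDf.continuousAt.norm.eventually (gt_mem_nhds (by linarith))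
  obtain ⟨ρ, hρ, hball⟩ := Metric.eventually_nhds_iff_ball.1
    ((hdiff.and hbdd).and ((show ∀ᶠ z in 𝓝 z₀, z ∈ s₁ from hs₁).and hN))
  -- The equation and its linearization are solved as one system, which is `C¹` because `f` is `C²`.
  -- A single Picard–Lindelöf application yields `Φ` and `L` on a common time interval, with
  -- Lipschitz dependence on the initial point.
  let W : E × (E →L[ℝ] E) → E × (E →L[ℝ] E) := fun w => (f w.1, fderiv ℝ f w.1 ∘L w.2)
  have hW : ContDiffAt ℝ 1 W (z₀, ContinuousLinearMap.id ℝ E) := by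
    refine ContDiffAt.prodMk ?_ ?_
    · exact ContDiffAt.comp (z₀, ContinuousLinearMap.id ℝ E) (f := Prod.fst) (g := f)
        (hf.of_le (by norm_num)) contDiffAt_fst
    · exact ContDiffAt.clm_comp (ContDiffAt.comp (z₀, ContinuousLinearMap.id ℝ E) (f := Prod.fst)
        (g := fderiv ℝ f) hDf contDiffAt_fst) contDiffAt_snd
  obtain ⟨ε₀, hε₀, a, r, L₀, K₀, hr, hpl⟩ := IsPicardLindelof.of_contDiffAt_one hW
  obtain ⟨α, hα, K', hK'⟩ :=
    (hpl 0).exists_forall_mem_closedBall_eq_hasDerivWithinAt_lipschitzOnWith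
  simp only [zero_sub, zero_add] at hα hK'
  have hmemr : ∀ z ∈ Metric.ball z₀ r, ((z, ContinuousLinearMap.id ℝ E) : E × (E →L[ℝ] E)) ∈
      Metric.closedBall (z₀, ContinuousLinearMap.id ℝ E) r := fun z hz => by
    rw [Metric.mem_closedBall, Prod.dist_eq]
    simpa using (Metric.mem_ball.1 hz).le
  set Φ : E → ℝ → E := fun z τ => (α (z, ContinuousLinearMap.id ℝ E) τ).1 with hΦ
  set L : E → ℝ → E →L[ℝ] E := fun z τ => (α (z, ContinuousLinearMap.id ℝ E) τ).2 with hL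
  have hz₀r : z₀ ∈ Metric.ball z₀ r := Metric.mem_ball_self hr
  have hd : ∀ z ∈ Metric.ball z₀ r, ∀ τ ∈ Icc (-ε₀) ε₀,
      HasDerivWithinAt (Φ z) (f (Φ z τ)) (Icc (-ε₀) ε₀) τ ∧
      HasDerivWithinAt (L z) (fderiv ℝ f (Φ z τ) ∘L L z τ) (Icc (-ε₀) ε₀) τ := by
    intro z hz τ hτ
    have h := (hα _ (hmemr z hz)).2 τ hτ
    exact ⟨h.fst, h.snd⟩
  have hlip : ∀ τ ∈ Icc (-ε₀) ε₀, LipschitzOnWith K' (Φ · τ) (Metric.ball z₀ r) := by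
    intro τ hτ
    refine LipschitzOnWith.of_dist_le_mul fun x hx y hy => ?_
    have h := (hK' τ hτ).dist_le_mul _ (hmemr x hx) _ (hmemr y hy)
    refine (le_trans ?_ h).trans (le_of_eq ?_)
    · exact le_max_left _ _
    · rw [Prod.dist_eq]; simp
  have h0 : ∀ z ∈ Metric.ball z₀ r, Φ z 0 = z := fun z hz => by
    simp only [hΦ, (hα _ (hmemr z hz)).1]
  have hL0 : ∀ z ∈ Metric.ball z₀ r, L z 0 = ContinuousLinearMap.id ℝ E := fun z hz => by
    simp only [hL, (hα _ (hmemr z hz)).1]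
  obtain ⟨ε, hε, hεε₀, hεball⟩ : ∃ ε > 0, ε ≤ ε₀ ∧ ∀ τ ∈ Icc 0 ε, dist (Φ z₀ τ) z₀ < ρ / 2 := by
    have hc : ContinuousAt (Φ z₀) 0 :=
      ((hd z₀ hz₀r 0 ⟨by linarith, hε₀.le⟩).1.hasDerivAt
        (Icc_mem_nhds (by linarith) hε₀)).continuousAt
    obtain ⟨ε, hε, h⟩ := Metric.continuousAt_iff.1 hc (ρ / 2) (by positivity)
    refine ⟨min (ε / 2) ε₀, by positivity, min_le_right _ _, fun τ hτ => ?_⟩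
    have h1 : τ ≤ ε / 2 := hτ.2.trans (min_le_left _ _)
    have := h (x := τ) (by rw [Real.dist_eq, sub_zero, abs_of_nonneg hτ.1]; linarith)
    rwa [h0 z₀ hz₀r] at this
  have hIcc : Icc 0 ε ⊆ Icc (-ε₀) ε₀ := Icc_subset_Icc (by linarith) hεε₀
  -- The trajectory of `z₀` stays within `ρ / 2` of `z₀`; for starting points in this radius the
  -- Lipschitz bound costs at most another `ρ / 2`.
  set r' : ℝ := min r (ρ / (2 * (K' + 1))) with hr'
  have hr'0 : 0 < r' := lt_min hr (by positivity)
  have hsub : Metric.ball z₀ r' ⊆ Metric.ball z₀ r := Metric.ball_subset_ball (min_le_left _ _)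
  have hmem : ∀ y ∈ Metric.ball z₀ r', ∀ τ ∈ Icc 0 ε, Φ y τ ∈ Metric.ball z₀ ρ := by
    intro y hy τ hτ
    have h1 := (hlip τ (hIcc hτ)).dist_le_mul y (hsub hy) z₀ hz₀r
    have h2 : dist y z₀ < ρ / (2 * (K' + 1)) := (Metric.mem_ball.1 hy).trans_le (min_le_right _ _)
    have h3 : (K' : ℝ) * dist y z₀ ≤ ρ / 2 := by
      rw [lt_div_iff₀ (by positivity)] at h2
      nlinarith [dist_nonneg (x := y) (y := z₀), K'.2]
    rw [Metric.mem_ball]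
    have := dist_triangle (Φ y τ) (Φ z₀ τ) z₀
    have := hεball τ hτ
    linarith
  refine ⟨ε, hε, Metric.ball z₀ r', Metric.ball_mem_nhds _ hr'0, Φ, L, Metric.isOpen_ball,
    fun z hz => ⟨h0 z (hsub hz), fun τ hτ => ⟨(hball _ (hmem z hz τ hτ)).2.2,
      (hd z (hsub hz) τ (hIcc hτ)).1.mono hIcc, (hd z (hsub hz) τ (hIcc hτ)).2.mono hIcc, ?_⟩⟩⟩
  refine hasFDerivAt_flow (s := Metric.ball z₀ ρ) (K := K) (M := ‖fderiv ℝ f z₀‖₊ + 1) (K' := K')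
    (f := f) (ε := ε) (convex_ball _ _) (fun w hw => (hball w hw).1.1)
    (hK.mono fun w hw => (hball w hw).2.1) (fun w hw => by simpa using (hball w hw).1.2.le)
    (Metric.isOpen_ball.mem_nhds hz) (fun y hy => h0 y (hsub hy)) hmem
    (fun y hy τ hτ => (hd y (hsub hy) τ (hIcc hτ)).1.mono hIcc)
    (fun τ hτ => (hlip τ (hIcc hτ)).mono hsub) (hL0 z (hsub hz))
    (fun τ hτ => (hd z (hsub hz) τ (hIcc hτ)).2.mono hIcc) τ hτ

end Flow

/-! ### Linear equations preserving a moving subspace -/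

section Transport

variable {E F G : Type*} [NormedAddCommGroup E] [NormedSpace ℝ E] [NormedAddCommGroup F]
  [NormedSpace ℝ F] [NormedAddCommGroup G] [NormedSpace ℝ G]

theorem ringInverse_comp_apply {B : F →L[ℝ] F} (hB : IsUnit B) (x : F) :
    Ring.inverse B (B x) = x := by
  have := Ring.inverse_mul_cancel B hB
  exact congrArg (fun T : F →L[ℝ] F => T x) this

theorem apply_ringInverse {B : F →L[ℝ] F} (hB : IsUnit B) (x : F) :
    B (Ring.inverse B x) = x := by
  have := Ring.mul_inverse_cancel B hB
  exact congrArg (fun T : F →L[ℝ] F => T x) this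

/-- If the range of `B` is invariant under the linear equation `J' = A J`, then a solution that
starts in this range stays there, and its coordinates satisfy a linear equation. -/
theorem exists_coords_of_linear_ode [CompleteSpace F] {α β : ℝ} (hαβ : α < β)
    {A : ℝ → E →L[ℝ] E} {B : ℝ → F →L[ℝ] E} {C : ℝ → F →L[ℝ] F} {J : ℝ → E} {P : E →L[ℝ] F}
    (hA : ContinuousOn A (Icc α β))
    (hB : ∀ s ∈ Icc α β, HasDerivWithinAt B (A s ∘L B s + B s ∘L C s) (Icc α β) s)
    (hJ : ∀ s ∈ Icc α β, HasDerivWithinAt J (A s (J s)) (Icc α β) s)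
    (hP : ∀ s ∈ Icc α β, IsUnit (P ∘L B s)) (hα : J α ∈ range (B α)) :
    ∃ a : ℝ → F, ∀ s ∈ Icc α β, J s = B s (a s) ∧
      HasDerivWithinAt a (-C s (a s)) (Icc α β) s := by
  -- If `J = B a`, then necessarily `a = (P B)⁻¹ P J`. This formula defines a differentiable
  -- candidate, and the remainder `R = J - B a` has to be shown to vanish.
  set N : ℝ → F →L[ℝ] F := fun s => Ring.inverse (P ∘L B s) with hN
  set a : ℝ → F := fun s => N s (P (J s)) with ha
  have hPB : ∀ s ∈ Icc α β, HasDerivWithinAt (fun s => P ∘L B s)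
      (P ∘L (A s ∘L B s + B s ∘L C s)) (Icc α β) s := fun s hs => by
    have := (hasDerivWithinAt_const s (Icc α β) P).clm_comp (hB s hs)
    simpa using this
  have hNd : ∀ s ∈ Icc α β, DifferentiableWithinAt ℝ N (Icc α β) s := by
    intro s hs
    obtain ⟨U, hU⟩ := hP s hs
    have h1 : DifferentiableAt ℝ Ring.inverse (P ∘L B s) := by
      rw [← hU]; exact (hasFDerivAt_ringInverse U).differentiableAt
    exact h1.comp_differentiableWithinAt s (hPB s hs).differentiableWithinAt
  have had : ∀ s ∈ Icc α β, DifferentiableWithinAt ℝ a (Icc α β) s := fun s hs =>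
    (hNd s hs).clm_apply
      (P.differentiableAt.comp_differentiableWithinAt s (hJ s hs).differentiableWithinAt)
  set a' : ℝ → F := fun s => derivWithin a (Icc α β) s with ha'
  have had' : ∀ s ∈ Icc α β, HasDerivWithinAt a (a' s) (Icc α β) s := fun s hs =>
    (had s hs).hasDerivWithinAt
  set R : ℝ → E := fun s => J s - B s (a s) with hR
  have hRd : ∀ s ∈ Icc α β, HasDerivWithinAt R (A s (R s) - B s (C s (a s) + a' s))
      (Icc α β) s := by
    intro s hs
    have := (hJ s hs).fun_sub ((hB s hs).clm_apply (had' s hs))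
    convert this using 1
    simp [hR]; abel
  have hPR : ∀ s ∈ Icc α β, P (R s) = 0 := fun s hs => by
    have := apply_ringInverse (hP s hs) (P (J s))
    simp only [hR, map_sub, ha, hN]
    rw [ContinuousLinearMap.comp_apply] at this
    rw [this, sub_self]
  -- Differentiating `P R = 0` expresses `C a + a'` linearly through `R`. Thus `R` solves a
  -- homogeneous linear equation with zero initial value, and no continuity of `C` is needed.
  have hkey : ∀ s ∈ Icc α β, C s (a s) + a' s = N s (P (A s (R s))) := by
    intro s hs
    have h1 : HasDerivWithinAt (fun s => P (R s)) (P (A s (R s) - B s (C s (a s) + a' s)))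
        (Icc α β) s := by
      have := (hasDerivWithinAt_const s (Icc α β) P).clm_apply (hRd s hs)
      simpa using this
    have h2 : HasDerivWithinAt (fun s => P (R s)) 0 (Icc α β) s :=
      (hasDerivWithinAt_const s (Icc α β) (0 : F)).congr hPR (hPR s hs)
    have h3 := (uniqueDiffOn_Icc hαβ s hs).eq_deriv _ h1 h2
    rw [map_sub, sub_eq_zero] at h3
    rw [h3]
    exact (ringInverse_comp_apply (hP s hs) _).symm
  obtain ⟨KA, hKA⟩ := isCompact_Icc.exists_bound_of_continuousOn hA
  obtain ⟨KB, hKB⟩ := isCompact_Icc.exists_bound_of_continuousOn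
    (fun s hs => (hB s hs).continuousWithinAt : ContinuousOn B (Icc α β))
  obtain ⟨KN, hKN⟩ := isCompact_Icc.exists_bound_of_continuousOn
    (fun s hs => (hNd s hs).continuousWithinAt : ContinuousOn N (Icc α β))
  have hR0 : R α = 0 := by
    obtain ⟨b, hb⟩ := hα
    have h1 : a α = b := by
      simp only [ha, hN, ← hb]
      exact ringInverse_comp_apply (hP α (left_mem_Icc.2 hαβ.le)) b
    simp [hR, h1, hb]
  have hRz : ∀ s ∈ Icc α β, R s = 0 := by
    refine eq_zero_of_abs_deriv_le_mul_abs_self_of_eq_zero_right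
      (K := KA + KB * (KN * (‖P‖ * KA)))
      (fun s hs => (hRd s hs).continuousWithinAt)
      (fun s hs => (hRd s ⟨hs.1, hs.2.le⟩).mono_of_mem_nhdsWithin (Icc_mem_nhdsGE_of_mem hs))
      hR0 ?_
    intro s hs
    have hs' : s ∈ Icc α β := ⟨hs.1, hs.2.le⟩
    rw [hkey s hs']
    have h1 : ‖A s (R s)‖ ≤ KA * ‖R s‖ := (A s).le_of_opNorm_le (hKA s hs') _
    have hKB0 : 0 ≤ KB := (norm_nonneg _).trans (hKB s hs')
    have hKN0 : 0 ≤ KN := (norm_nonneg _).trans (hKN s hs')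
    have h2 : ‖B s (N s (P (A s (R s))))‖ ≤ KB * (KN * (‖P‖ * (KA * ‖R s‖))) :=
      ((B s).le_of_opNorm_le (hKB s hs') _).trans <| mul_le_mul_of_nonneg_left
        (((N s).le_of_opNorm_le (hKN s hs') _).trans <| mul_le_mul_of_nonneg_left
          ((P.le_opNorm _).trans <| mul_le_mul_of_nonneg_left h1 (norm_nonneg _)) hKN0) hKB0
    calc _ ≤ ‖A s (R s)‖ + ‖B s (N s (P (A s (R s))))‖ := norm_sub_le _ _
      _ ≤ KA * ‖R s‖ + KB * (KN * (‖P‖ * (KA * ‖R s‖))) := add_le_add h1 h2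
      _ = _ := by ring
  refine ⟨a, fun s hs => ⟨sub_eq_zero.1 (hRz s hs), ?_⟩⟩
  have h1 := hkey s hs
  rw [hRz s hs, map_zero, map_zero, map_zero] at h1
  rw [← eq_neg_of_add_eq_zero_right h1]
  exact had' s hs

/-- A linear map that is a left inverse of `B` stays invertible when composed with nearby maps. -/
theorem exists_leftInverse_near [FiniteDimensional ℝ E] [FiniteDimensional ℝ F] {B : F →L[ℝ] E}
    (hB : Function.Injective B) :
    ∃ P : E →L[ℝ] F, ∀ᶠ B' in 𝓝 B, IsUnit (P ∘L B') := by
  obtain ⟨p, hp⟩ := LinearMap.exists_leftInverse_of_injective (B : F →ₗ[ℝ] E)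
    (LinearMap.ker_eq_bot.2 hB)
  set P : E →L[ℝ] F := LinearMap.toContinuousLinearMap p
  refine ⟨P, ?_⟩
  have h1 : P ∘L B = 1 := by
    ext x
    exact congrArg (fun T : F →ₗ[ℝ] F => T x) hp
  have hc : Continuous fun B' : F →L[ℝ] E => P ∘L B' := by fun_prop
  have hopen : IsOpen {T : F →L[ℝ] F | IsUnit T} :=
    have : CompleteSpace F := FiniteDimensional.complete ℝ F
    Units.isOpen
  exact hc.continuousAt.eventually (hopen.mem_nhds (by
    change IsUnit (P ∘L B)
    rw [h1]
    exact isUnit_one))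

/-- The coordinates of a smooth map in a smooth family of linearly independent vectors are
smooth. -/
theorem contDiffAt_coords [FiniteDimensional ℝ E] [FiniteDimensional ℝ F] {n : WithTop ℕ∞}
    {B : G → F →L[ℝ] E} {Z : G → E} {a : G → F} {x₀ : G} (hB : ContDiffAt ℝ n B x₀)
    (hZ : ContDiffAt ℝ n Z x₀) (hinj : Function.Injective (B x₀))
    (ha : ∀ᶠ x in 𝓝 x₀, B x (a x) = Z x) : ContDiffAt ℝ n a x₀ := by
  have : CompleteSpace F := FiniteDimensional.complete ℝ F
  obtain ⟨P, hP⟩ := exists_leftInverse_near hinj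
  -- Near `x₀` the coordinates are `(P B)⁻¹ P Z`, and inversion is smooth on the units.
  have h1 : ContDiffAt ℝ n (fun x => Ring.inverse (P ∘L B x) (P (Z x))) x₀ := by
    refine ContDiffAt.clm_apply ?_ (P.contDiff.contDiffAt.comp x₀ hZ)
    obtain ⟨U, hU⟩ := hP.self_of_nhds
    have h2 : ContDiffAt ℝ n Ring.inverse (P ∘L B x₀) := by
      rw [← hU]; exact contDiffAt_ringInverse ℝ U
    exact h2.comp x₀ (contDiffAt_const.clm_comp hB)
  refine h1.congr_of_eventuallyEq ?_
  filter_upwards [ha, hB.continuousAt.eventually hP] with x hx hx'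
  rw [← hx]
  exact (ringInverse_comp_apply hx' _).symm

end Transport

/-! ### Vector fields, brackets and integral curves in a chart -/

section Chart

variable {E : Type*} [NormedAddCommGroup E] [NormedSpace ℝ E]
  {M : Type*} [TopologicalSpace M] [ChartedSpace E M]

/-- The coordinates of tangent vectors at `x` in the chart at `p`. -/
def chartVec (p x : M) : TangentSpace 𝓘(ℝ, E) x →L[ℝ] E :=
  mfderiv 𝓘(ℝ, E) 𝓘(ℝ, E) (extChartAt 𝓘(ℝ, E) p) x

/-- The vector field `Y` read in the chart at `p`. -/
def chartField (p : M) (Y : VField E M) (z : E) : E :=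
  chartVec p ((extChartAt 𝓘(ℝ, E) p).symm z) (Y ((extChartAt 𝓘(ℝ, E) p).symm z))

theorem chartField_apply {p x : M} (hx : x ∈ (extChartAt 𝓘(ℝ, E) p).source) (Y : VField E M) :
    chartField p Y (extChartAt 𝓘(ℝ, E) p x) = chartVec p x (Y x) := by
  rw [chartField, (extChartAt 𝓘(ℝ, E) p).left_inv hx]

/-- All tangent spaces are copies of `E`, so a change between equal base points needs no cast of the
vector. -/
theorem chartVec_congr {p y y' : M} (h : y = y') (w : E) :
    chartVec p y (w : TangentSpace 𝓘(ℝ, E) y) = chartVec p y' (w : TangentSpace 𝓘(ℝ, E) y') := by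
  subst h
  rfl

/-- The derivative of a function along an integral curve. -/
theorem hasDerivWithinAt_comp_of_isMIntegralCurveOn {X : VField E M} {γ : ℝ → M} {S : Set ℝ}
    (hγ : IsMIntegralCurveOn γ X S) {t : ℝ} (ht : t ∈ S) {f : M → ℝ}
    (hf : MDifferentiableAt 𝓘(ℝ, E) 𝓘(ℝ, ℝ) f (γ t)) :
    HasDerivWithinAt (fun s => f (γ s)) (derivAlong X f (γ t)) S t := by
  have h2 := hf.hasMFDerivAt.comp_hasMFDerivWithinAt t (hγ t ht)
  refine hasMFDerivWithinAt_iff_hasFDerivWithinAt.1 (h2.congr_mfderiv ?_)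
  exact ContinuousLinearMap.ext fun a =>
    (mfderiv 𝓘(ℝ, E) 𝓘(ℝ, ℝ) f (γ t)).map_smul (a : ℝ) (X (γ t))

variable [IsManifold 𝓘(ℝ, E) ∞ M]

theorem isInvertible_chartVec {p x : M} (hx : x ∈ (extChartAt 𝓘(ℝ, E) p).source) :
    (chartVec (E := E) p x).IsInvertible :=
  have : IsManifold 𝓘(ℝ, E) 1 M := .of_le (n := ∞) (by norm_cast)
  isInvertible_mfderiv_extChartAt hx

theorem chartVec_injective {p x : M} (hx : x ∈ (extChartAt 𝓘(ℝ, E) p).source) :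
    Function.Injective (chartVec (E := E) p x) :=
  (isInvertible_chartVec hx).injective

/-- The derivatives of the chart and of its inverse are mutually inverse. This makes the results on
pullbacks of fields, smoothness and naturality of the bracket, available for `chartField`. -/
theorem chartField_eq_mpullback {p : M} {z : E} (hz : z ∈ (extChartAt 𝓘(ℝ, E) p).target)
    (Y : VField E M) : chartField p Y z =
      VectorField.mpullback 𝓘(ℝ, E) 𝓘(ℝ, E) (extChartAt 𝓘(ℝ, E) p).symm Y z := by
  have : IsManifold 𝓘(ℝ, E) 1 M := .of_le (n := ∞) (by norm_cast)
  have h1 := mfderiv_extChartAt_comp_mfderivWithin_extChartAt_symm (I := 𝓘(ℝ, E)) hz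
  have h2 := isInvertible_mfderivWithin_extChartAt_symm (I := 𝓘(ℝ, E)) hz
  have h3 : range 𝓘(ℝ, E) = univ := by simp
  rw [h3, mfderivWithin_univ] at h1 h2
  rw [VectorField.mpullback_apply, chartField, chartVec]
  obtain ⟨A, hA⟩ := h2
  rw [← hA] at h1 ⊢
  rw [ContinuousLinearMap.inverse_equiv]
  have h4 := congrArg (fun T => T (A.symm (Y ((extChartAt 𝓘(ℝ, E) p).symm z)))) h1
  simp only [ContinuousLinearMap.comp_apply] at h4
  erw [A.apply_symm_apply] at h4
  exact h4

theorem contDiffAt_chartField [CompleteSpace E] {p x : M} {Y : VField E M} {U : Set M} (hU : IsOpen U)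
    (hY : SmoothFieldOn Y U) (hxU : x ∈ U) (hx : x ∈ (extChartAt 𝓘(ℝ, E) p).source) :
    ContDiffAt ℝ ∞ (chartField p Y) (extChartAt 𝓘(ℝ, E) p x) := by
  set z := extChartAt 𝓘(ℝ, E) p x with hz
  have hzt : z ∈ (extChartAt 𝓘(ℝ, E) p).target := (extChartAt 𝓘(ℝ, E) p).map_source hx
  have hopen : (extChartAt 𝓘(ℝ, E) p).target ∈ 𝓝 z := (isOpen_extChartAt_target p).mem_nhds hzt
  have hsymm : ContMDiffAt 𝓘(ℝ, E) 𝓘(ℝ, E) ∞ (extChartAt 𝓘(ℝ, E) p).symm z :=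
    (contMDiffOn_extChartAt_symm p).contMDiffAt hopen
  have hinv : (mfderiv 𝓘(ℝ, E) 𝓘(ℝ, E) (extChartAt 𝓘(ℝ, E) p).symm z).IsInvertible := by
    have : IsManifold 𝓘(ℝ, E) 1 M := .of_le (n := ∞) (by norm_cast)
    have h2 := isInvertible_mfderivWithin_extChartAt_symm (I := 𝓘(ℝ, E)) hzt
    have h3 : range 𝓘(ℝ, E) = univ := by simp
    rwa [h3, mfderivWithin_univ] at h2
  have hxs : (extChartAt 𝓘(ℝ, E) p).symm z = x := (extChartAt 𝓘(ℝ, E) p).left_inv hx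
  have hY' : ContMDiffAt 𝓘(ℝ, E) 𝓘(ℝ, E).tangent ∞
      (fun x => (⟨x, Y x⟩ : TangentBundle 𝓘(ℝ, E) M)) ((extChartAt 𝓘(ℝ, E) p).symm z) := by
    rw [hxs]; exact hY.contMDiffAt (hU.mem_nhds hxU)
  have h := ContMDiffAt.mpullback_vectorField_preimage (m := ∞) (n := ∞) hY' hsymm hinv
    (by norm_num)
  have h' := contMDiffAt_vectorSpace_iff_contDiffAt.1 h
  refine h'.congr_of_eventuallyEq ?_
  filter_upwards [hopen] with w hw
  exact chartField_eq_mpullback hw Y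

theorem mdifferentiableAt_of_smoothFieldOn {x : M} {Y : VField E M} {U : Set M} (hU : IsOpen U)
    (hY : SmoothFieldOn Y U) (hxU : x ∈ U) : MDifferentiableAt 𝓘(ℝ, E) 𝓘(ℝ, E).tangent
      (fun x => (⟨x, Y x⟩ : TangentBundle 𝓘(ℝ, E) M)) x :=
  (hY.contMDiffAt (hU.mem_nhds hxU)).mdifferentiableAt (by simp)

/-- The bracket is natural under pullback by the inverse chart, and in a vector space it is `DY(X) -
DX(Y)`. -/
theorem chartVec_bracket [CompleteSpace E] {p x : M} {X Y : VField E M} {U : Set M} (hU : IsOpen U)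
    (hX : SmoothFieldOn X U) (hY : SmoothFieldOn Y U) (hxU : x ∈ U)
    (hx : x ∈ (extChartAt 𝓘(ℝ, E) p).source) :
    chartVec p x (bracket X Y x) =
      fderiv ℝ (chartField p Y) (extChartAt 𝓘(ℝ, E) p x) (chartVec p x (X x)) -
      fderiv ℝ (chartField p X) (extChartAt 𝓘(ℝ, E) p x) (chartVec p x (Y x)) := by
  set z := extChartAt 𝓘(ℝ, E) p x with hz
  have hzt : z ∈ (extChartAt 𝓘(ℝ, E) p).target := (extChartAt 𝓘(ℝ, E) p).map_source hx
  have hopen : (extChartAt 𝓘(ℝ, E) p).target ∈ 𝓝 z := (isOpen_extChartAt_target p).mem_nhds hzt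
  have hsymm : ContMDiffAt 𝓘(ℝ, E) 𝓘(ℝ, E) ∞ (extChartAt 𝓘(ℝ, E) p).symm z :=
    (contMDiffOn_extChartAt_symm p).contMDiffAt hopen
  have hxs : (extChartAt 𝓘(ℝ, E) p).symm z = x := (extChartAt 𝓘(ℝ, E) p).left_inv hx
  have hm : IsManifold 𝓘(ℝ, E) (minSmoothness ℝ 2) M :=
    .of_le (n := ∞) (by simp; norm_cast)
  have hm' : IsManifold 𝓘(ℝ, E) (minSmoothness ℝ 2) E := inferInstance
  have h := VectorField.mpullback_mlieBracket (I := 𝓘(ℝ, E)) (I' := 𝓘(ℝ, E)) (n := ∞)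
    (f := (extChartAt 𝓘(ℝ, E) p).symm) (x₀ := z) (V := X) (W := Y)
    (by rw [hxs]; exact mdifferentiableAt_of_smoothFieldOn hU hX hxU)
    (by rw [hxs]; exact mdifferentiableAt_of_smoothFieldOn hU hY hxU) hsymm
    (by simp; norm_cast)
  have hXe : VectorField.mpullback 𝓘(ℝ, E) 𝓘(ℝ, E) (extChartAt 𝓘(ℝ, E) p).symm X =ᶠ[𝓝 z]
      chartField p X := by
    filter_upwards [hopen] with w hw using (chartField_eq_mpullback hw X).symm
  have hYe : VectorField.mpullback 𝓘(ℝ, E) 𝓘(ℝ, E) (extChartAt 𝓘(ℝ, E) p).symm Y =ᶠ[𝓝 z]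
      chartField p Y := by
    filter_upwards [hopen] with w hw using (chartField_eq_mpullback hw Y).symm
  have h1 : VectorField.mlieBracket 𝓘(ℝ, E)
      (VectorField.mpullback 𝓘(ℝ, E) 𝓘(ℝ, E) (extChartAt 𝓘(ℝ, E) p).symm X)
      (VectorField.mpullback 𝓘(ℝ, E) 𝓘(ℝ, E) (extChartAt 𝓘(ℝ, E) p).symm Y) z =
      VectorField.lieBracket ℝ (chartField p X) (chartField p Y) z := by
    rw [← hXe.lieBracket_vectorField_eq hYe, ← VectorField.mlieBracketWithin_univ,
      VectorField.mlieBracketWithin_eq_lieBracketWithin]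
    exact congrFun VectorField.lieBracketWithin_univ z
  have h2 : chartVec p x (bracket X Y x) =
      VectorField.lieBracket ℝ (chartField p X) (chartField p Y) z := by
    rw [← chartField_apply hx]
    exact (chartField_eq_mpullback hzt _).trans (h.trans h1)
  rw [h2, VectorField.lieBracket, hz, chartField_apply hx, chartField_apply hx]

theorem smoothFieldOn_bracket [CompleteSpace E] {X Y : VField E M} {U : Set M} (hU : IsOpen U)
    (hX : SmoothFieldOn X U) (hY : SmoothFieldOn Y U) : SmoothFieldOn (bracket X Y) U := by
  intro x hx
  have : IsManifold 𝓘(ℝ, E) (((⊤ : ℕ∞) : WithTop ℕ∞) + 1) M := by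
    have : (((⊤ : ℕ∞) : WithTop ℕ∞) + 1) = ∞ := rfl
    rw [this]; infer_instance
  have hm : IsManifold 𝓘(ℝ, E) (minSmoothness ℝ 2) M := .of_le (n := ∞) (by simp; norm_cast)
  exact (ContMDiffAt.mlieBracket_vectorField (m := ⊤) (n := ⊤)
    (hX.contMDiffAt (hU.mem_nhds hx)) (hY.contMDiffAt (hU.mem_nhds hx))
    (by simp)).contMDiffWithinAt

/-- An integral curve read in a chart. -/
theorem hasDerivWithinAt_chart_of_isMIntegralCurveOn {X : VField E M} {γ : ℝ → M} {S : Set ℝ}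
    {p : M} (hγ : IsMIntegralCurveOn γ X S) {t : ℝ} (ht : t ∈ S)
    (hx : γ t ∈ (extChartAt 𝓘(ℝ, E) p).source) :
    HasDerivWithinAt (fun s => extChartAt 𝓘(ℝ, E) p (γ s)) (chartVec p (γ t) (X (γ t))) S t := by
  have : IsManifold 𝓘(ℝ, E) 1 M := .of_le (n := ∞) (by norm_cast)
  have h1 : HasMFDerivAt 𝓘(ℝ, E) 𝓘(ℝ, E) (extChartAt 𝓘(ℝ, E) p) (γ t) (chartVec p (γ t)) :=
    (mdifferentiableAt_extChartAt (by simpa using hx)).hasMFDerivAt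
  have h2 := h1.comp_hasMFDerivWithinAt t (hγ t ht)
  refine hasMFDerivWithinAt_iff_hasFDerivWithinAt.1 (h2.congr_mfderiv ?_)
  exact ContinuousLinearMap.ext fun a => (chartVec p (γ t)).map_smul (a : ℝ) (X (γ t))

end Chart

/-! ### Integral curves and local flows on the manifold -/

section FlowOnManifold

variable {E : Type*} [NormedAddCommGroup E] [NormedSpace ℝ E]
  {M : Type*} [TopologicalSpace M] [ChartedSpace E M]

/-- Concatenation of integral curves. -/
theorem isMIntegralCurveOn_concat {X : VField E M} {γ₁ γ₂ : ℝ → M} {a b d : ℝ} (hab : a ≤ b)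
    (hbd : b ≤ d) (h₁ : IsMIntegralCurveOn γ₁ X (Icc a b))
    (h₂ : IsMIntegralCurveOn γ₂ X (Icc b d)) (hb : γ₁ b = γ₂ b) :
    IsMIntegralCurveOn (fun s => if s ≤ b then γ₁ s else γ₂ s) X (Icc a d) := by
  set γ : ℝ → M := fun s => if s ≤ b then γ₁ s else γ₂ s with hγ
  have e₁ : ∀ s ∈ Icc a b, γ s = γ₁ s := fun s hs => by simp [hγ, hs.2]
  have e₂ : ∀ s ∈ Icc b d, γ s = γ₂ s := fun s hs => by
    rcases eq_or_lt_of_le hs.1 with h | h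
    · simp [hγ, ← h, hb]
    · simp [hγ, not_le.2 h]
  have H₁ : IsMIntegralCurveOn γ X (Icc a b) := fun s hs => by
    rw [e₁ s hs]
    exact (h₁ s hs).congr_of_eventuallyEq
      (eventually_of_mem self_mem_nhdsWithin e₁) (e₁ s hs)
  have H₂ : IsMIntegralCurveOn γ X (Icc b d) := fun s hs => by
    rw [e₂ s hs]
    exact (h₂ s hs).congr_of_eventuallyEq
      (eventually_of_mem self_mem_nhdsWithin e₂) (e₂ s hs)
  intro s hs
  rcases lt_trichotomy s b with h | h | h
  · refine (H₁ s ⟨hs.1, h.le⟩).mono_of_mem_nhdsWithin ?_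
    filter_upwards [self_mem_nhdsWithin, nhdsWithin_le_nhds (Iio_mem_nhds h)] with r hr hr'
    exact ⟨hr.1, hr'.le⟩
  · rw [← Icc_union_Icc_eq_Icc hab hbd]
    exact (H₁ s ⟨hs.1, h.le⟩).union (H₂ s ⟨h.ge, hs.2⟩)
  · refine (H₂ s ⟨h.le, hs.2⟩).mono_of_mem_nhdsWithin ?_
    filter_upwards [self_mem_nhdsWithin, nhdsWithin_le_nhds (Ioi_mem_nhds h)] with r hr hr'
    exact ⟨hr'.le, hr.2⟩

variable [IsManifold 𝓘(ℝ, E) ∞ M]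

/-- Uniqueness of integral curves on a compact interval, given the initial point. -/
theorem eqOn_Icc_of_isMIntegralCurveOn [CompleteSpace E] [T2Space M] {X : VField E M}
    (hX : SmoothFieldOn X univ) {γ γ' : ℝ → M} {t : ℝ} (hγ : IsMIntegralCurveOn γ X (Icc 0 t))
    (hγ' : IsMIntegralCurveOn γ' X (Icc 0 t)) (h0 : γ 0 = γ' 0) : EqOn γ γ' (Icc 0 t) := by
  rcases le_or_gt t 0 with ht | ht
  · intro s hs
    obtain rfl : s = 0 := le_antisymm (hs.2.trans ht) hs.1
    exact h0
  have hm : IsManifold 𝓘(ℝ, E) 1 M := .of_le (n := ∞) (by norm_cast)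
  have hX1 : ContMDiff 𝓘(ℝ, E) 𝓘(ℝ, E).tangent 1
      (fun x => (⟨x, X x⟩ : TangentBundle 𝓘(ℝ, E) M)) :=
    (contMDiffOn_univ.1 hX).of_le (by norm_cast)
  -- The uniqueness theorem applied below concerns open intervals. Both curves are therefore
  -- prolonged to negative times by the same curve `η`, and the right endpoint is recovered by
  -- continuity.
  obtain ⟨η, hη0, hη⟩ := exists_isMIntegralCurveAt_of_contMDiffAt_boundaryless (t₀ := 0)
    (hX1 (γ 0))
  obtain ⟨ε, hε, hηε⟩ := isMIntegralCurveAt_iff'.1 hη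
  have hηI : IsMIntegralCurveOn η X (Icc (-(ε / 2)) 0) := hηε.mono fun s hs => by
    rw [Metric.mem_ball, Real.dist_eq, sub_zero, abs_of_nonpos hs.2]
    linarith [hs.1]
  have hg : ∀ {β : ℝ → M}, IsMIntegralCurveOn β X (Icc 0 t) → η 0 = β 0 →
      IsMIntegralCurveOn (fun s => if s ≤ 0 then η s else β s) X (Ioo (-(ε / 2)) t) :=
    fun hβ hβ0 => (isMIntegralCurveOn_concat (by linarith) ht.le hηI hβ hβ0).mono
      Ioo_subset_Icc_self
  have heq := isMIntegralCurveOn_Ioo_eqOn_of_contMDiff_boundaryless (t₀ := 0)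
    ⟨by linarith, ht⟩ hX1 (hg hγ hη0) (hg hγ' (hη0.trans h0)) (by simp)
  have hIco : EqOn γ γ' (Ico 0 t) := by
    intro s hs
    rcases eq_or_lt_of_le hs.1 with h | h
    · rw [← h, h0]
    · simpa [not_le.2 h] using heq ⟨by linarith, hs.2⟩
  have hcl : closure (Ico 0 t) = Icc 0 t := closure_Ico ht.ne
  exact hIco.of_subset_closure hγ.continuousOn hγ'.continuousOn Ico_subset_Icc_self hcl.ge

/-- `flow` picks an arbitrary integral curve from the given point; uniqueness makes the choice
irrelevant. -/
theorem flow_eq [CompleteSpace E] [T2Space M] {X : VField E M} (hX : SmoothFieldOn X univ)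
    {γ : ℝ → M} {t : ℝ} (ht : 0 ≤ t) (hγ : IsMIntegralCurveOn γ X (Icc 0 t)) :
    flow X t (γ 0) = γ t := by
  have h : ∃ γ' : ℝ → M, γ' 0 = γ 0 ∧ IsMIntegralCurveOn γ' X (Icc 0 t) := ⟨γ, rfl, hγ⟩
  rw [flow, dif_pos h]
  exact eqOn_Icc_of_isMIntegralCurveOn hX h.choose_spec.2 hγ h.choose_spec.1 ⟨ht, le_rfl⟩

theorem hasMFDerivAt_extChartAt_symm {p : M} {z : E}
    (hz : z ∈ (extChartAt 𝓘(ℝ, E) p).target) :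
    HasMFDerivAt 𝓘(ℝ, E) 𝓘(ℝ, E) (extChartAt 𝓘(ℝ, E) p).symm z
      (mfderiv 𝓘(ℝ, E) 𝓘(ℝ, E) (extChartAt 𝓘(ℝ, E) p).symm z) := by
  have hsymm : ContMDiffAt 𝓘(ℝ, E) 𝓘(ℝ, E) ∞ (extChartAt 𝓘(ℝ, E) p).symm z :=
    (contMDiffOn_extChartAt_symm p).contMDiffAt ((isOpen_extChartAt_target p).mem_nhds hz)
  exact (hsymm.mdifferentiableAt (by simp)).hasMFDerivAt

theorem mfderiv_symm_chartField {p : M} {z : E} (hz : z ∈ (extChartAt 𝓘(ℝ, E) p).target)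
    (X : VField E M) :
    mfderiv 𝓘(ℝ, E) 𝓘(ℝ, E) (extChartAt 𝓘(ℝ, E) p).symm z (chartField (E := E) p X z) =
      X ((extChartAt 𝓘(ℝ, E) p).symm z) := by
  have : IsManifold 𝓘(ℝ, E) 1 M := .of_le (n := ∞) (by norm_cast)
  have h2 := isInvertible_mfderivWithin_extChartAt_symm (I := 𝓘(ℝ, E)) hz
  have h3 : range 𝓘(ℝ, E) = univ := by simp
  rw [h3, mfderivWithin_univ] at h2
  have h4 : chartField p X z = (mfderiv 𝓘(ℝ, E) 𝓘(ℝ, E) (extChartAt 𝓘(ℝ, E) p).symm z).inverse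
      (X ((extChartAt 𝓘(ℝ, E) p).symm z)) := chartField_eq_mpullback hz X
  rw [h4]
  obtain ⟨A, hA⟩ := h2
  rw [← hA, ContinuousLinearMap.inverse_equiv]
  exact A.apply_symm_apply _

/-- A solution of the equation in a chart gives an integral curve. -/
theorem isMIntegralCurveOn_of_chart {X : VField E M} {p : M} {u : ℝ → E} {S : Set ℝ}
    (hu : ∀ s ∈ S, HasDerivWithinAt u (chartField p X (u s)) S s)
    (hmem : ∀ s ∈ S, u s ∈ (extChartAt 𝓘(ℝ, E) p).target) :
    IsMIntegralCurveOn (fun s => (extChartAt 𝓘(ℝ, E) p).symm (u s)) X S := by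
  intro s hs
  have h1 := (hasMFDerivAt_extChartAt_symm (hmem s hs)).comp_hasMFDerivWithinAt s
    (hasMFDerivWithinAt_iff_hasFDerivWithinAt.2 (hu s hs).hasFDerivWithinAt)
  refine h1.congr_mfderiv ?_
  rw [← mfderiv_symm_chartField (hmem s hs) X]
  exact ContinuousLinearMap.ext fun a =>
    (mfderiv 𝓘(ℝ, E) 𝓘(ℝ, E) (extChartAt 𝓘(ℝ, E) p).symm (u s)).map_smul (a : ℝ)
      (chartField (E := E) p X (u s))

/-- `Φ` is a flow of `X` for times in `[0, ε]`, defined on the open set `W` and staying in the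
domain of the chart at `p`; its derivative in the initial point exists and satisfies the
variational equation in this chart. -/
structure IsLocalFlow (X : VField E M) (p : M) (ε : ℝ) (W : Set M) (Φ : M → ℝ → M) : Prop where
  isOpen : IsOpen W
  zero : ∀ y ∈ W, Φ y 0 = y
  integralCurve : ∀ y ∈ W, IsMIntegralCurveOn (Φ y) X (Icc 0 ε)
  mem_source : ∀ y ∈ W, ∀ τ ∈ Icc 0 ε, Φ y τ ∈ (extChartAt 𝓘(ℝ, E) p).source
  mdifferentiableAt : ∀ y ∈ W, ∀ τ ∈ Icc 0 ε,
    MDifferentiableAt 𝓘(ℝ, E) 𝓘(ℝ, E) (Φ · τ) y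
  variational : ∀ y ∈ W, ∀ v : TangentSpace 𝓘(ℝ, E) y, ∀ τ ∈ Icc 0 ε,
    HasDerivWithinAt
      (fun τ => chartVec p (Φ y τ) (mfderiv 𝓘(ℝ, E) 𝓘(ℝ, E) (Φ · τ) y v))
      (fderiv ℝ (chartField p X) (extChartAt 𝓘(ℝ, E) p (Φ y τ))
        (chartVec p (Φ y τ) (mfderiv 𝓘(ℝ, E) 𝓘(ℝ, E) (Φ · τ) y v))) (Icc 0 ε) τ

/-- The local flow of the field read in the chart is carried back to `M`. In the chart its
derivative is `L` composed with the derivative of the chart, so the equation for `L` becomes the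
variational equation. -/
theorem exists_isLocalFlow [CompleteSpace E] {X : VField E M} (hX : SmoothFieldOn X univ) (p : M) :
    ∃ ε > 0, ∃ (W : Set M) (Φ : M → ℝ → M), p ∈ W ∧ IsLocalFlow X p ε W Φ := by
  have hm : IsManifold 𝓘(ℝ, E) 1 M := .of_le (n := ∞) (by norm_cast)
  set φ := extChartAt 𝓘(ℝ, E) p with hφ
  have hps : p ∈ φ.source := mem_extChartAt_source p
  have hsm : ContDiffAt ℝ 2 (chartField p X) (φ p) :=
    (contDiffAt_chartField isOpen_univ hX (mem_univ p) hps).of_le (by norm_cast)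
  obtain ⟨ε, hε, O, hO, Φ', L, hOo, h⟩ := exists_local_flow hsm
    ((isOpen_extChartAt_target p).mem_nhds (φ.map_source hps))
  set W : Set M := φ.source ∩ φ ⁻¹' O with hW
  have hWo : IsOpen W := isOpen_extChartAt_preimage' p hOo
  set Φ : M → ℝ → M := fun y τ => φ.symm (Φ' (φ y) τ) with hΦ
  have hφΦ : ∀ y ∈ W, ∀ τ ∈ Icc 0 ε, φ (Φ y τ) = Φ' (φ y) τ := fun y hy τ hτ =>
    φ.right_inv ((h (φ y) hy.2).2 τ hτ).1
  have hsrc : ∀ y ∈ W, ∀ τ ∈ Icc 0 ε, Φ y τ ∈ φ.source := fun y hy τ hτ =>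
    φ.map_target ((h (φ y) hy.2).2 τ hτ).1
  have hchart : ∀ y ∈ φ.source, HasMFDerivAt 𝓘(ℝ, E) 𝓘(ℝ, E) φ y (chartVec p y) := fun y hy =>
    (mdifferentiableAt_extChartAt (by simpa [hφ] using hy)).hasMFDerivAt
  have hflow : ∀ y ∈ W, ∀ τ ∈ Icc 0 ε, HasMFDerivAt 𝓘(ℝ, E) 𝓘(ℝ, E)
      (fun y => Φ' (φ y) τ) y (L (φ y) τ ∘L chartVec p y) := fun y hy τ hτ =>
    HasMFDerivAt.comp y (hasMFDerivAt_iff_hasFDerivAt.2 ((h (φ y) hy.2).2 τ hτ).2.2.2)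
      (hchart y hy.1)
  have hdiff : ∀ y ∈ W, ∀ τ ∈ Icc 0 ε, MDifferentiableAt 𝓘(ℝ, E) 𝓘(ℝ, E) (Φ · τ) y :=
    fun y hy τ hτ => (HasMFDerivAt.comp y
      (hasMFDerivAt_extChartAt_symm ((h (φ y) hy.2).2 τ hτ).1) (hflow y hy τ hτ)).mdifferentiableAt
  have hvec : ∀ y ∈ W, ∀ v : TangentSpace 𝓘(ℝ, E) y, ∀ τ ∈ Icc 0 ε,
      chartVec p (Φ y τ) (mfderiv 𝓘(ℝ, E) 𝓘(ℝ, E) (Φ · τ) y v) = L (φ y) τ (chartVec p y v) := by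
    intro y hy v τ hτ
    have h1 := HasMFDerivAt.comp y (hchart _ (hsrc y hy τ hτ)) (hdiff y hy τ hτ).hasMFDerivAt
    have h2 : (φ ∘ (Φ · τ)) =ᶠ[𝓝 y] fun y => Φ' (φ y) τ := by
      filter_upwards [hWo.mem_nhds hy] with w hw using hφΦ w hw τ hτ
    have h3 := hasMFDerivAt_unique (h1.congr_of_eventuallyEq h2.symm) (hflow y hy τ hτ)
    exact congrArg (fun T : TangentSpace 𝓘(ℝ, E) y →L[ℝ] E => T v) h3
  refine ⟨ε, hε, W, Φ, ⟨hps, (mem_of_mem_nhds hO : φ p ∈ O)⟩, hWo, fun y hy => ?_, fun y hy => ?_, hsrc,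
    hdiff, fun y hy v τ hτ => ?_⟩
  · simp only [hΦ, (h (φ y) hy.2).1]
    exact φ.left_inv hy.1
  · exact isMIntegralCurveOn_of_chart (fun τ hτ => ((h (φ y) hy.2).2 τ hτ).2.1)
      (fun τ hτ => ((h (φ y) hy.2).2 τ hτ).1)
  · have hL := ((h (φ y) hy.2).2 τ hτ).2.2.1.clm_apply
      (hasDerivWithinAt_const τ (Icc 0 ε) (chartVec p y v))
    rw [map_zero, add_zero] at hL
    rw [hvec y hy v τ hτ, hφΦ y hy τ hτ]
    exact hL.congr (fun r hr => hvec y hy v r hr) (hvec y hy v τ hτ)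

end FlowOnManifold

/-! ### Differentiability of the flow map along a whole integral curve -/

section Continuation

variable {E : Type*} [NormedAddCommGroup E] [NormedSpace ℝ E]
  {M : Type*} [TopologicalSpace M] [ChartedSpace E M] [IsManifold 𝓘(ℝ, E) ∞ M]

/-- The flow map `exp(sX)` is defined near `x₀` and is differentiable at `x₀`. -/
structure FlowRegularAt (X : VField E M) (x₀ : M) (s : ℝ) : Prop where
  eventually_exists : ∀ᶠ y in 𝓝 x₀, ∃ γ : ℝ → M, γ 0 = y ∧ IsMIntegralCurveOn γ X (Icc 0 s)
  mdifferentiableAt : MDifferentiableAt 𝓘(ℝ, E) 𝓘(ℝ, E) (flow X s) x₀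

variable [CompleteSpace E] {X : VField E M} {x₀ p : M} {s t ε : ℝ} {W : Set M}
  {Φ : M → ℝ → M}

/-- Near the time `s₀`, an integral curve stays in the domain of a local flow for a time that
covers a neighbourhood of `s₀`. -/
theorem exists_localFlow_near (hX : SmoothFieldOn X univ) {c : ℝ → M}
    (hc : IsMIntegralCurveOn c X (Icc 0 t)) {s₀ : ℝ} (hs₀ : s₀ ∈ Icc 0 t) :
    ∃ δ > 0, ∃ (ε : ℝ) (W : Set M) (Φ : M → ℝ → M), IsLocalFlow X (c s₀) ε W Φ ∧ 2 * δ ≤ ε ∧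
      ∀ s ∈ Icc 0 t, s₀ - δ < s → s < s₀ + δ → c s ∈ W := by
  obtain ⟨ε, hε, W, Φ, hp, hΦ⟩ := exists_isLocalFlow hX (c s₀)
  have hcont := hc.continuousOn s₀ hs₀ (hΦ.isOpen.mem_nhds hp)
  obtain ⟨δ, hδ, h⟩ := Metric.mem_nhdsWithin_iff.1 hcont
  -- Two times within this distance of `s₀` differ by less than `ε`, so the local flow leads from
  -- one to the other.
  refine ⟨min δ (ε / 2), by positivity, ε, W, Φ, hΦ, ?_, fun s hs h1 h2 => h ⟨?_, hs⟩⟩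
  · linarith [min_le_right δ (ε / 2)]
  · rw [Metric.mem_ball, Real.dist_eq, abs_lt]
    constructor <;> linarith [min_le_left δ (ε / 2)]

variable [T2Space M]

/-- The semigroup law, by concatenation of integral curves. It is needed on a neighbourhood of `x₀`,
not only at `x₀`, so that it can be differentiated in the initial point. -/
theorem FlowRegularAt.eventuallyEq_flow_add (hX : SmoothFieldOn X univ)
    (hΦ : IsLocalFlow X p ε W Φ) (hs : 0 ≤ s) (hr : FlowRegularAt X x₀ s) (hW : flow X s x₀ ∈ W)
    {τ : ℝ} (hτ : τ ∈ Icc 0 ε) :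
    (∀ᶠ y in 𝓝 x₀, ∃ γ : ℝ → M, γ 0 = y ∧ IsMIntegralCurveOn γ X (Icc 0 (s + τ))) ∧
      flow X (s + τ) =ᶠ[𝓝 x₀] fun y => Φ (flow X s y) τ := by
  have hWn : ∀ᶠ y in 𝓝 x₀, flow X s y ∈ W :=
    hr.mdifferentiableAt.continuousAt (hΦ.isOpen.mem_nhds hW)
  have key : ∀ᶠ y in 𝓝 x₀, ∃ γ : ℝ → M, γ 0 = y ∧ IsMIntegralCurveOn γ X (Icc 0 (s + τ)) ∧
      γ (s + τ) = Φ (flow X s y) τ := by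
    filter_upwards [hWn, hr.eventually_exists] with y hy ⟨γ, hγ0, hγ⟩
    have hfl : flow X s y = γ s := by rw [← hγ0]; exact flow_eq hX hs hγ
    rw [hfl] at hy ⊢
    have h2 : IsMIntegralCurveOn (Φ (γ s) ∘ (· + -s)) X (Icc s (s + τ)) :=
      ((hΦ.integralCurve _ hy).comp_add (-s)).mono fun r hr => by
        simp only [mem_ofPred_eq]
        exact ⟨by linarith [hr.1], by linarith [hr.2, hτ.2]⟩
    have hz : γ s = (Φ (γ s) ∘ (· + -s)) s := by simp [hΦ.zero _ hy]
    refine ⟨_, ?_, isMIntegralCurveOn_concat hs (by linarith [hτ.1]) hγ h2 hz, ?_⟩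
    · simp [hs, hγ0]
    · rcases eq_or_lt_of_le hτ.1 with h | h
      · simp [← h, hΦ.zero _ hy]
      · simp [h]
  constructor
  · filter_upwards [key] with y ⟨γ, h0, h1, _⟩ using ⟨γ, h0, h1⟩
  · filter_upwards [key] with y ⟨γ, h0, h1, h2⟩
    rw [← h2, ← h0]
    exact flow_eq hX (by linarith [hτ.1]) h1

theorem FlowRegularAt.add (hX : SmoothFieldOn X univ)
    (hΦ : IsLocalFlow X p ε W Φ) (hs : 0 ≤ s) (hr : FlowRegularAt X x₀ s) (hW : flow X s x₀ ∈ W)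
    {τ : ℝ} (hτ : τ ∈ Icc 0 ε) : FlowRegularAt X x₀ (s + τ) := by
  obtain ⟨h1, h2⟩ := hr.eventuallyEq_flow_add hX hΦ hs hW hτ
  refine ⟨h1, ?_⟩
  have h3 := (hΦ.mdifferentiableAt _ hW τ hτ).comp x₀ hr.mdifferentiableAt
  exact h3.congr_of_eventuallyEq h2

theorem flow_zero (hX : SmoothFieldOn X univ) (y : M) : flow X 0 y = y := by
  obtain ⟨ε, hε, W, Φ, hp, hΦ⟩ := exists_isLocalFlow hX y
  have h := flow_eq hX le_rfl ((hΦ.integralCurve y hp).mono (Icc_subset_Icc le_rfl hε.le))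
  rwa [hΦ.zero y hp] at h

theorem flowRegularAt_zero (hX : SmoothFieldOn X univ) (x₀ : M) : FlowRegularAt X x₀ 0 := by
  obtain ⟨ε, hε, W, Φ, hp, hΦ⟩ := exists_isLocalFlow hX x₀
  refine ⟨?_, ?_⟩
  · filter_upwards [hΦ.isOpen.mem_nhds hp] with y hy
    exact ⟨Φ y, hΦ.zero y hy, (hΦ.integralCurve y hy).mono (Icc_subset_Icc le_rfl hε.le)⟩
  · have : flow X 0 = id := funext (flow_zero hX)
    rw [this]
    exact mdifferentiableAt_id

/-- The flow map along an integral curve is defined near the initial point and differentiable. -/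
theorem flowRegularAt (hX : SmoothFieldOn X univ) {c : ℝ → M}
    (hc : IsMIntegralCurveOn c X (Icc 0 t)) : ∀ s ∈ Icc 0 t, FlowRegularAt X (c 0) s := by
  refine forall_Icc_of_locally_propagates (flowRegularAt_zero hX _) fun s₀ hs₀ => ?_
  obtain ⟨δ, hδ, ε, W, Φ, hΦ, hε, hW⟩ := exists_localFlow_near hX hc hs₀
  refine ⟨δ, hδ, fun s₁ hs₁ s hs h1 h2 h3 h4 hr => ?_⟩
  have hfl := flow_eq hX hs₁.1 (hc.mono (Icc_subset_Icc le_rfl hs₁.2))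
  have := hr.add hX hΦ hs₁.1 (by rw [hfl]; exact hW s₁ hs₁ h1 (by linarith))
    (τ := s - s₁) ⟨by linarith, by linarith⟩
  rwa [add_sub_cancel] at this

/-- The derivative of the flow map along an integral curve satisfies the variational equation in
charts. -/
theorem variational_equation (hX : SmoothFieldOn X univ) {c : ℝ → M}
    (hc : IsMIntegralCurveOn c X (Icc 0 t)) (h0 : c 0 = x₀) (v : TangentSpace 𝓘(ℝ, E) x₀) {s₀ : ℝ}
    (hs₀ : s₀ ∈ Icc 0 t) :
    ∃ δ > 0, ∀ α ∈ Icc 0 t, s₀ - δ < α → α ≤ s₀ → ∀ β ∈ Icc 0 t, β < s₀ + δ →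
      ∀ s ∈ Icc α β, flow X s x₀ ∈ (extChartAt 𝓘(ℝ, E) (c s₀)).source ∧
        HasDerivWithinAt (fun s => chartVec (c s₀) (flow X s x₀)
            (mfderiv 𝓘(ℝ, E) 𝓘(ℝ, E) (flow X s) x₀ v))
          (fderiv ℝ (chartField (c s₀) X) (extChartAt 𝓘(ℝ, E) (c s₀) (flow X s x₀))
            (chartVec (c s₀) (flow X s x₀) (mfderiv 𝓘(ℝ, E) 𝓘(ℝ, E) (flow X s) x₀ v)))
          (Icc α β) s := by
  subst h0
  obtain ⟨δ, hδ, ε, W, Φ, hΦ, hε, hW⟩ := exists_localFlow_near hX hc hs₀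
  refine ⟨δ, hδ, fun α hα h1 h2 β hβ h3 => ?_⟩
  have hr := flowRegularAt hX hc α hα
  have hfl := flow_eq hX hα.1 (hc.mono (Icc_subset_Icc le_rfl hα.2))
  have hWα : flow X α (c 0) ∈ W := by rw [hfl]; exact hW α hα h1 (by linarith)
  set w := mfderiv 𝓘(ℝ, E) 𝓘(ℝ, E) (flow X α) (c 0) v with hw
  have hτ : ∀ s ∈ Icc α β, s - α ∈ Icc 0 ε := fun s hs =>
    ⟨by linarith [hs.1], by linarith [hs.2]⟩
  -- On all of `[α, β]` the flow factors through time `α`. By the chain rule the transported vector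
  -- is the image of the fixed vector `w` under the derivative of `Φ`, which obeys the variational
  -- equation.
  have hev : ∀ s ∈ Icc α β, flow X s =ᶠ[𝓝 (c 0)] fun y => Φ (flow X α y) (s - α) := fun s hs => by
    have := (hr.eventuallyEq_flow_add hX hΦ hα.1 hWα (hτ s hs)).2
    rwa [add_sub_cancel] at this
  have hpt : ∀ s ∈ Icc α β, flow X s (c 0) = Φ (flow X α (c 0)) (s - α) := fun s hs =>
    (hev s hs).self_of_nhds
  have hvec : ∀ s ∈ Icc α β, chartVec (c s₀) (flow X s (c 0))
      (mfderiv 𝓘(ℝ, E) 𝓘(ℝ, E) (flow X s) (c 0) v) =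
      chartVec (c s₀) (Φ (flow X α (c 0)) (s - α))
        (mfderiv 𝓘(ℝ, E) 𝓘(ℝ, E) (Φ · (s - α)) (flow X α (c 0)) w) := by
    intro s hs
    have h4 := HasMFDerivAt.comp (c 0) (hΦ.mdifferentiableAt _ hWα _ (hτ s hs)).hasMFDerivAt
      hr.mdifferentiableAt.hasMFDerivAt
    have h5 := (h4.congr_of_eventuallyEq (hev s hs)).mfderiv
    exact (congrArg (chartVec (c s₀) (flow X s (c 0))) (DFunLike.congr_fun h5 v)).trans
      (chartVec_congr (hpt s hs) _)
  intro s hs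
  refine ⟨by rw [hpt s hs]; exact hΦ.mem_source _ hWα _ (hτ s hs), ?_⟩
  have h6 := (hΦ.variational _ hWα w _ (hτ s hs)).scomp_of_eq s (h := fun s => s - α)
    ((hasDerivWithinAt_id s (Icc α β)).sub_const α) (fun r hr => hτ r hr) rfl
  rw [one_smul] at h6
  rw [hvec s hs, hpt s hs]
  exact h6.congr hvec (hvec s hs)

end Continuation

/-! ### Coefficients in smooth frames and the Leibniz rule -/

section Frames

theorem injective_sum_smul {ι F : Type*} [Fintype ι] [AddCommGroup F] [Module ℝ F] {b : ι → F}
    (hb : LinearIndependent ℝ b) : Function.Injective fun a : ι → ℝ => ∑ i, a i • b i :=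
  fun u v huv => hb.fintypeLinearCombination_injective (by
    simpa [Fintype.linearCombination_apply] using huv)

theorem coeffs_sum {ι F : Type*} [Fintype ι] [AddCommGroup F] [Module ℝ F] {b : ι → F}
    (hb : LinearIndependent ℝ b) (a : ι → ℝ) : coeffs b (∑ i, a i • b i) = a :=
  Function.leftInverse_invFun (injective_sum_smul hb) a

theorem sum_coeffs {ι F : Type*} [Fintype ι] [AddCommGroup F] [Module ℝ F] {b : ι → F} {v : F}
    (hv : v ∈ Submodule.span ℝ (range b)) : ∑ i, coeffs b v i • b i = v := by
  have h : ∃ a : ι → ℝ, ∑ i, a i • b i = v := (Submodule.mem_span_range_iff_exists_fun ℝ).1 hv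
  exact Function.invFun_eq (f := fun c : ι → ℝ => ∑ i, c i • b i) h

variable {E : Type*} [NormedAddCommGroup E] [NormedSpace ℝ E]
  {M : Type*} [TopologicalSpace M] [ChartedSpace E M]

theorem derivAlong_congr {X : VField E M} {f g : M → ℝ} {x : M} (h : f =ᶠ[𝓝 x] g) :
    derivAlong X f x = derivAlong X g x := by
  rw [derivAlong, derivAlong, h.mfderiv_eq]
  rfl

theorem bracket_congr {X Y Z : VField E M} {x : M} (h : Y =ᶠ[𝓝 x] Z) :
    bracket X Y x = bracket X Z x :=
  (EventuallyEq.refl _ X).mlieBracket_vectorField_eq h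

/-- The linear map with the given values on the standard basis. -/
def frameMap {ι : Type*} [Fintype ι] (y : ι → E) : (ι → ℝ) →L[ℝ] E :=
  ∑ i, (ContinuousLinearMap.proj (R := ℝ) (φ := fun _ : ι => ℝ) i).smulRight (y i)

theorem frameMap_apply {ι : Type*} [Fintype ι] (y : ι → E) (a : ι → ℝ) :
    frameMap y a = ∑ i, a i • y i := by
  simp [frameMap]

variable [IsManifold 𝓘(ℝ, E) ∞ M]

/-- The coefficients of a smooth field in a smooth linearly independent family are
differentiable. -/
theorem mdifferentiableAt_coeff [FiniteDimensional ℝ E] {ι : Type*} [Fintype ι]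
    {Y : ι → VField E M} {Z : VField E M} {a : M → ι → ℝ} {U : Set M} {x : M} (hU : IsOpen U)
    (hx : x ∈ U) (hY : ∀ i, SmoothFieldOn (Y i) U) (hZ : SmoothFieldOn Z U)
    (hli : LinearIndependent ℝ fun i => Y i x) (ha : ∀ y ∈ U, Z y = ∑ i, a y i • Y i y) (i : ι) :
    MDifferentiableAt 𝓘(ℝ, E) 𝓘(ℝ, ℝ) (fun y => a y i) x := by
  have hm : IsManifold 𝓘(ℝ, E) 1 M := .of_le (n := ∞) (by norm_cast)
  have : CompleteSpace E := FiniteDimensional.complete ℝ E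
  set φ := extChartAt 𝓘(ℝ, E) x with hφ
  have hxs : x ∈ φ.source := mem_extChartAt_source x
  have hB : ContDiffAt ℝ ∞ (fun z => frameMap fun i => chartField x (Y i) z) (φ x) := by
    refine ContDiffAt.sum fun i _ => ?_
    exact contDiffAt_const.smulRight (contDiffAt_chartField hU (hY i) hx hxs)
  have hinj : Function.Injective (frameMap fun i => chartField x (Y i) (φ x)) := by
    have h1 : LinearIndependent ℝ fun i => chartVec x x (Y i x) :=
      hli.map' (chartVec x x).toLinearMap (LinearMap.ker_eq_bot.2 (chartVec_injective hxs))
    intro u v huv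
    refine injective_sum_smul h1 ?_
    simp only [frameMap_apply, hφ] at huv
    simpa only [chartField_apply hxs] using huv
  have hcoord : ContDiffAt ℝ ∞ (fun z => a (φ.symm z)) (φ x) := by
    refine contDiffAt_coords hB (contDiffAt_chartField hU hZ hx hxs) hinj ?_
    have h1 : ∀ᶠ z in 𝓝 (φ x), φ.symm z ∈ U :=
      (continuousAt_extChartAt_symm (I := 𝓘(ℝ, E)) x).preimage_mem_nhds
        (by rw [extChartAt_to_inv]; exact hU.mem_nhds hx)
    filter_upwards [h1] with z hz
    rw [frameMap_apply, chartField, ha _ hz, map_sum]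
    simp only [map_smul]
    rfl
  have h2 : ContDiffAt ℝ ∞ (fun z => a (φ.symm z) i) (φ x) := (contDiffAt_pi.1 hcoord) i
  have h3 : MDifferentiableAt 𝓘(ℝ, E) 𝓘(ℝ, ℝ) (fun z => a (φ.symm z) i) (φ x) :=
    (h2.differentiableAt (by simp)).mdifferentiableAt
  have h4 := h3.comp x (mdifferentiableAt_extChartAt (I := 𝓘(ℝ, E)) (mem_chart_source E x))
  refine h4.congr_of_eventuallyEq ?_
  filter_upwards [(isOpen_extChartAt_source (I := 𝓘(ℝ, E)) x).mem_nhds hxs] with y hy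
  simp only [Function.comp_apply]
  rw [φ.left_inv hy]

theorem bracket_sum_smul [FiniteDimensional ℝ E] {ι : Type*} [Fintype ι] {X : VField E M}
    {Y : ι → VField E M} {a : ι → M → ℝ} {x : M}
    (hY : ∀ i, MDifferentiableAt 𝓘(ℝ, E) 𝓘(ℝ, E).tangent
      (fun x => (⟨x, Y i x⟩ : TangentBundle 𝓘(ℝ, E) M)) x)
    (ha : ∀ i, MDifferentiableAt 𝓘(ℝ, E) 𝓘(ℝ, ℝ) (a i) x) :
    bracket X (fun y => ∑ i, a i y • Y i y) x =
      ∑ i, derivAlong X (a i) x • Y i x + ∑ i, a i x • bracket X (Y i) x := by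
  classical
  have hm1 : IsManifold 𝓘(ℝ, E) 1 M := .of_le (n := ∞) (by norm_cast)
  have hm2 : IsManifold 𝓘(ℝ, E) 2 M := .of_le (n := ∞) (by norm_cast)
  have : CompleteSpace E := FiniteDimensional.complete ℝ E
  have hsec : ∀ i, MDifferentiableAt 𝓘(ℝ, E) 𝓘(ℝ, E).tangent
      (fun x => (⟨x, (a i • Y i) x⟩ : TangentBundle 𝓘(ℝ, E) M)) x := fun i =>
    (ha i).smul_section (hY i)
  have key : ∀ s : Finset ι, bracket X (fun y => ∑ i ∈ s, a i y • Y i y) x =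
      ∑ i ∈ s, derivAlong X (a i) x • Y i x + ∑ i ∈ s, a i x • bracket X (Y i) x := by
    intro s
    induction s using Finset.induction_on with
    | empty =>
      simp only [Finset.sum_empty, add_zero]
      exact congrFun VectorField.mlieBracket_zero_right x
    | insert j s hj ih =>
      have h1 : (fun y => ∑ i ∈ insert j s, a i y • Y i y) =
          (a j • Y j) + fun y => ∑ i ∈ s, (a i • Y i) y := by
        funext y
        simp [Finset.sum_insert hj]
      have h2 : MDifferentiableAt 𝓘(ℝ, E) 𝓘(ℝ, E).tangent
          (fun x => (⟨x, ∑ i ∈ s, (a i • Y i) x⟩ : TangentBundle 𝓘(ℝ, E) M)) x :=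
        .sum_section fun i _ => hsec i
      rw [h1, bracket, VectorField.mlieBracket_add_right (hsec j) h2,
        VectorField.mlieBracket_smul_right (ha j) (hY j), Finset.sum_insert hj,
        Finset.sum_insert hj]
      have h3 : VectorField.mlieBracket 𝓘(ℝ, E) X (fun y => ∑ i ∈ s, (a i • Y i) y) x = _ := ih
      rw [h3]
      change derivAlong X (a j) x • Y j x + _ + _ = _
      abel
  exact key Finset.univ

/-- A combination of sections with constant coefficients. -/
theorem smoothFieldOn_sum_smul {ι : Type*} [Fintype ι] {Y : ι → VField E M} {U : Set M}
    (hY : ∀ i, SmoothFieldOn (Y i) U) (b : ι → ℝ) :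
    SmoothFieldOn (fun y => ∑ i, b i • Y i y) U := by
  exact ContMDiffOn.sum_section fun i _ => (hY i).const_smul_section (a := b i)

end Frames

/-! ### The frame `e, [X, e]`, the canonical form and the vertical part -/

section SemiHamiltonian

variable {E : Type*} [NormedAddCommGroup E] [NormedSpace ℝ E]
  {M : Type*} [TopologicalSpace M] [ChartedSpace E M]
  {m : ℕ} {X : VField E M} {V D : PlaneField E M} {σ : FormField E M} {U : Set M}
  {e : Fin m → VField E M}

/-- The family `e₁, …, e_m, [X, e₁], …, [X, e_m]`. -/
def doubleFrame (X : VField E M) (e : Fin m → VField E M) : Fin m ⊕ Fin m → VField E M :=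
  Sum.elim e fun i => bracket X (e i)

theorem sum_doubleFrame (a : Fin m ⊕ Fin m → ℝ) (x : M) :
    ∑ k, a k • doubleFrame X e k x =
      ∑ i, a (.inl i) • e i x + ∑ i, a (.inr i) • bracket X (e i) x := by
  rw [Fintype.sum_sum_type]
  rfl

variable [IsManifold 𝓘(ℝ, E) ∞ M]

theorem IsFrame.isSection (he : IsFrame V U e) (i : Fin m) : IsSection V U (e i) where
  isOpen := he.isOpen
  smooth := he.smooth i
  mem x hx := by
    rw [← he.span_eq x hx]
    exact Submodule.subset_span ⟨i, rfl⟩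

theorem IsRegularSemiHamiltonian.isSection_frame (hq : IsRegularSemiHamiltonian m X V D σ)
    (he : IsFrame V U e) (i : Fin m) : IsSection D U (e i) where
  isOpen := he.isOpen
  smooth := he.smooth i
  mem x hx := hq.le x ((he.isSection i).mem x hx)

/-- A section of `V` with a given value exists. -/
theorem IsFrame.extend_spec (he : IsFrame V U e) {x : M} (hx : x ∈ U) {v : TangentSpace 𝓘(ℝ, E) x}
    (hv : v ∈ V x) : extend V x v x = v ∧ ∃ U' : Set M, x ∈ U' ∧ IsSection V U' (extend V x v) := by
  have h : ∃ Y : VField E M, Y x = v ∧ ∃ U : Set M, x ∈ U ∧ IsSection V U Y := by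
    rw [← he.span_eq x hx] at hv
    obtain ⟨b, hb⟩ := (Submodule.mem_span_range_iff_exists_fun ℝ).1 hv
    refine ⟨fun y => ∑ i, b i • e i y, hb, U, hx, he.isOpen, smoothFieldOn_sum_smul he.smooth b,
      fun y hy => Submodule.sum_mem _ fun i _ => Submodule.smul_mem _ _ ((he.isSection i).mem y hy)⟩
  rw [extend, dif_pos h]
  exact h.choose_spec

/-- The curvature operator in the frame that defines it. -/
theorem curvature_eq {x : M} (he : IsFrame V U (localFrame V m x)) (hx : x ∈ U) (b : Fin m → ℝ) :
    curvature m X V x (∑ i, b i • localFrame V m x i x) =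
      ∑ i, (curvatureMatrix X (localFrame V m x) x).mulVec b i • localFrame V m x i x := by
  rw [curvature, coeffs_sum (he.linearIndependent x hx)]

theorem localFrame_spec (hV : IsDistribution V m) (x : M) :
    ∃ U : Set M, x ∈ U ∧ IsFrame V U (localFrame V m x) := by
  have h : ∃ e : Fin m → VField E M, ∃ U : Set M, x ∈ U ∧ IsFrame V U e := by
    obtain ⟨U, e, h⟩ := hV x
    exact ⟨e, U, h⟩
  rw [localFrame, dif_pos h]
  exact h.choose_spec

variable [FiniteDimensional ℝ E]

theorem IsRegularSemiHamiltonian.isSection_bracket (hq : IsRegularSemiHamiltonian m X V D σ)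
    {Y : VField E M} (hY : IsSection D U Y) : IsSection D U (bracket X Y) where
  isOpen := hY.isOpen
  smooth :=
    have : CompleteSpace E := FiniteDimensional.complete ℝ E
    smoothFieldOn_bracket hY.isOpen (hq.smooth_field.mono (subset_univ _)) hY.smooth
  mem := hq.invariant U Y hY

theorem IsRegularSemiHamiltonian.isSection_doubleFrame
    (hq : IsRegularSemiHamiltonian m X V D σ) (he : IsFrame V U e) (i : Fin m ⊕ Fin m) :
    IsSection D U (doubleFrame X e i) := by
  rcases i with i | i
  · exact hq.isSection_frame he i
  · exact hq.isSection_bracket (hq.isSection_frame he i)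

/-- For a section `Y` of `V`, the class of `[X, Y]` modulo `V` is tensorial in `Y`. -/
theorem IsFrame.bracket_sub_mem (he : IsFrame V U e) {x : M} (hx : x ∈ U) {U' : Set M}
    {Y : VField E M} (hY : IsSection V U' Y) (hx' : x ∈ U') {b : Fin m → ℝ}
    (hb : Y x = ∑ i, b i • e i x) :
    bracket X Y x - ∑ i, b i • bracket X (e i) x ∈ V x := by
  set a : M → Fin m → ℝ := fun y => coeffs (fun i => e i y) (Y y) with ha
  have hO : IsOpen (U ∩ U') := he.isOpen.inter hY.isOpen
  have hYa : ∀ y ∈ U ∩ U', Y y = ∑ i, a y i • e i y := fun y hy => by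
    refine (sum_coeffs ?_).symm
    rw [he.span_eq y hy.1]
    exact hY.mem y hy.2
  have had : ∀ i, MDifferentiableAt 𝓘(ℝ, E) 𝓘(ℝ, ℝ) (fun y => a y i) x :=
    mdifferentiableAt_coeff hO ⟨hx, hx'⟩ (fun i => (he.smooth i).mono inter_subset_left)
      (hY.smooth.mono inter_subset_right) (he.linearIndependent x hx) hYa
  have h1 : bracket X Y x = bracket X (fun y => ∑ i, a y i • e i y) x :=
    bracket_congr (eventually_of_mem (hO.mem_nhds ⟨hx, hx'⟩) hYa)
  have hax : a x = b := by
    rw [ha]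
    simp only [hb]
    exact coeffs_sum (he.linearIndependent x hx) b
  -- By the Leibniz rule the only discrepancy consists of the terms `X(a i) • e i`, which lie in
  -- `V`.
  rw [h1, bracket_sum_smul (a := fun i y => a y i)
    (fun i => mdifferentiableAt_of_smoothFieldOn he.isOpen (he.smooth i) hx) had, hax,
    add_sub_cancel_right]
  exact Submodule.sum_mem _ fun i _ => Submodule.smul_mem _ _ ((he.isSection i).mem x hx)

/-- Modulo `V`, the bracket of `X` with any section of `V` is a combination of the `[X, e i]`, so `V
+ [X, V] = D` is already generated by these and the `e i`. -/
theorem IsRegularSemiHamiltonian.span_doubleFrame (hq : IsRegularSemiHamiltonian m X V D σ)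
    (he : IsFrame V U e) {x : M} (hx : x ∈ U) :
    Submodule.span ℝ (range fun k => doubleFrame X e k x) = D x := by
  refine le_antisymm (Submodule.span_le.2 ?_) ?_
  · rintro _ ⟨k, rfl⟩
    exact (hq.isSection_doubleFrame he k).mem x hx
  · set S := Submodule.span ℝ (range fun k => doubleFrame X e k x) with hS
    have hVS : V x ≤ S := by
      rw [← he.span_eq x hx]
      refine Submodule.span_mono ?_
      rintro _ ⟨i, rfl⟩
      exact ⟨.inl i, rfl⟩
    rw [← hq.addBracket_eq x, addBracket]
    refine sup_le hVS (Submodule.span_le.2 ?_)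
    rintro w ⟨U', Y, hx', hY, rfl⟩
    obtain ⟨b, hb⟩ : ∃ b : Fin m → ℝ, ∑ i, b i • e i x = Y x :=
      (Submodule.mem_span_range_iff_exists_fun ℝ).1 (by
        rw [he.span_eq x hx]; exact hY.mem x hx')
    have h1 := hVS (he.bracket_sub_mem (X := X) hx hY hx' hb.symm)
    have h2 : ∑ i, b i • bracket X (e i) x ∈ S := Submodule.sum_mem _ fun i _ =>
      Submodule.smul_mem _ _ (Submodule.subset_span ⟨.inr i, rfl⟩)
    have := S.add_mem h1 h2
    rwa [sub_add_cancel] at this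

/-- These are `2 m` vectors spanning a space of dimension `2 m`. -/
theorem IsRegularSemiHamiltonian.linearIndependent_doubleFrame
    (hq : IsRegularSemiHamiltonian m X V D σ) (he : IsFrame V U e) {x : M} (hx : x ∈ U) :
    LinearIndependent ℝ fun k => doubleFrame X e k x := by
  rw [linearIndependent_iff_card_eq_finrank_span, Set.finrank, hq.span_doubleFrame he hx]
  obtain ⟨U', e', hx', he'⟩ := hq.distribution_D x
  rw [← he'.span_eq x hx', finrank_span_eq_card (he'.linearIndependent x hx')]
  simp [two_mul]

/-- The structure equation `[X, [X, e]] = e H₀ + [X, e] H₁`. -/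
theorem IsRegularSemiHamiltonian.bracket_bracket (hq : IsRegularSemiHamiltonian m X V D σ)
    (he : IsFrame V U e) {y : M} (hy : y ∈ U) (j : Fin m) :
    bracket X (bracket X (e j)) y =
      ∑ k, structureCoeffs X e y j k • doubleFrame X e k y := by
  have h1 : bracket X (bracket X (e j)) y ∈ D y :=
    (hq.isSection_bracket (hq.isSection_bracket (hq.isSection_frame he j))).mem y hy
  rw [← hq.span_doubleFrame he hy] at h1
  have h2 : (fun k => doubleFrame X e k y) =
      Sum.elim (fun i => e i y) fun i => bracket X (e i) y := by
    funext k; rcases k with k | k <;> rfl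
  have h3 := (sum_coeffs h1).symm
  rw [h2] at h3
  rw [h3]
  refine Finset.sum_congr rfl fun k _ => ?_
  rcases k with k | k <;> rfl

/-- Ensures that the term `X(H₁)` in the curvature matrix is a true derivative along integral curves
and not the default value of `mfderiv`. -/
theorem IsRegularSemiHamiltonian.mdifferentiableAt_matrixH1
    (hq : IsRegularSemiHamiltonian m X V D σ) (he : IsFrame V U e) {x : M} (hx : x ∈ U)
    (i j : Fin m) : MDifferentiableAt 𝓘(ℝ, E) 𝓘(ℝ, ℝ) (fun y => matrixH1 X e y i j) x :=
  mdifferentiableAt_coeff (a := fun y => structureCoeffs X e y j) he.isOpen hx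
    (fun k => (hq.isSection_doubleFrame he k).smooth)
    (hq.isSection_bracket (hq.isSection_bracket (hq.isSection_frame he j))).smooth
    (hq.linearIndependent_doubleFrame he hx) (fun _ hy => hq.bracket_bracket he hy j) (.inr i)

/-- The matrix of the canonical form in a frame. -/
def gram (X : VField E M) (σ : FormField E M) (e : Fin m → VField E M) (x : M) :
    Matrix (Fin m) (Fin m) ℝ :=
  Matrix.of fun i j => σ x (bracket X (e i) x) (e j x)

/-- Apply `X` to `σ (e i, e j) = 0`, using the invariance and skewness of `σ`. -/
theorem IsRegularSemiHamiltonian.gram_symm (hq : IsRegularSemiHamiltonian m X V D σ)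
    (he : IsFrame V U e) {x : M} (hx : x ∈ U) (i j : Fin m) :
    gram X σ e x i j = gram X σ e x j i := by
  have h1 := hq.invariant_form U (e i) (e j) (hq.isSection_frame he i) (hq.isSection_frame he j)
    x hx
  have h2 : (fun y => σ y (e i y) (e j y)) =ᶠ[𝓝 x] fun _ => (0 : ℝ) :=
    eventually_of_mem (he.isOpen.mem_nhds hx) fun y hy =>
      hq.lagrangian y _ ((he.isSection i).mem y hy) _ ((he.isSection j).mem y hy)
  have h3 : derivAlong X (fun _ : M => (0 : ℝ)) x = 0 := by
    rw [derivAlong, mfderiv_const]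
    rfl
  rw [derivAlong_congr h2, h3] at h1
  have h4 := hq.skew x _ ((hq.isSection_frame he i).mem x hx) _
    ((hq.isSection_bracket (hq.isSection_frame he j)).mem x hx)
  change σ x (bracket X (e i) x) (e j x) = σ x (bracket X (e j) x) (e i x)
  linarith

theorem IsRegularSemiHamiltonian.mdifferentiableAt_gram
    (hq : IsRegularSemiHamiltonian m X V D σ) (he : IsFrame V U e) {x : M} (hx : x ∈ U)
    (i j : Fin m) : MDifferentiableAt 𝓘(ℝ, E) 𝓘(ℝ, ℝ) (fun y => gram X σ e y i j) x :=
  ((hq.smooth_form U _ _ (hq.isSection_bracket (hq.isSection_frame he i))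
    (hq.isSection_frame he j)).contMDiffAt (he.isOpen.mem_nhds hx)).mdifferentiableAt (by simp)

/-- The canonical form is parallel: `X(G) = (H₁ᵀ G + G H₁) / 2`. -/
theorem IsRegularSemiHamiltonian.derivAlong_gram (hq : IsRegularSemiHamiltonian m X V D σ)
    (he : IsFrame V U e) {x : M} (hx : x ∈ U) (i j : Fin m) :
    derivAlong X (fun y => gram X σ e y i j) x =
      (1 / 2 : ℝ) * ((matrixH1 X e x).transpose * gram X σ e x +
        gram X σ e x * matrixH1 X e x) i j := by
  -- Since `V` is Lagrangian, the `H₀` part of `[X, [X, e i]]` drops out. The left side is symmetric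
  -- in `i, j` while `σ ([X, e i], [X, e j])` is skew, so averaging the two index orders removes the
  -- latter.
  have key : ∀ i j : Fin m, derivAlong X (fun y => gram X σ e y i j) x =
      ((matrixH1 X e x).transpose * gram X σ e x) i j +
        σ x (bracket X (e i) x) (bracket X (e j) x) := by
    intro i j
    have h1 := hq.invariant_form U _ _ (hq.isSection_bracket (hq.isSection_frame he i))
      (hq.isSection_frame he j) x hx
    change derivAlong X (fun y => σ y (bracket X (e i) y) (e j y)) x = _
    rw [h1, hq.bracket_bracket he hx i, sum_doubleFrame]
    congr 1
    rw [map_add, LinearMap.add_apply, map_sum, map_sum, LinearMap.sum_apply, LinearMap.sum_apply]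
    have h2 : ∑ k, (σ x (structureCoeffs X e x i (.inl k) • e k x)) (e j x) = 0 :=
      Finset.sum_eq_zero fun k _ => by
        rw [map_smul, LinearMap.smul_apply, hq.lagrangian x _ ((he.isSection k).mem x hx) _
          ((he.isSection j).mem x hx), smul_zero]
    rw [h2, zero_add, Matrix.mul_apply]
    refine Finset.sum_congr rfl fun k _ => ?_
    rw [map_smul, LinearMap.smul_apply]
    rfl
  have hsym : derivAlong X (fun y => gram X σ e y i j) x =
      derivAlong X (fun y => gram X σ e y j i) x :=
    derivAlong_congr (eventually_of_mem (he.isOpen.mem_nhds hx) fun y hy => hq.gram_symm he hy i j)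
  have hsk := hq.skew x _ ((hq.isSection_bracket (hq.isSection_frame he i)).mem x hx) _
    ((hq.isSection_bracket (hq.isSection_frame he j)).mem x hx)
  have ht : ((matrixH1 X e x).transpose * gram X σ e x) j i =
      (gram X σ e x * matrixH1 X e x) i j := by
    rw [Matrix.mul_apply, Matrix.mul_apply]
    refine Finset.sum_congr rfl fun k _ => ?_
    rw [hq.gram_symm he hx i k, Matrix.transpose_apply, mul_comm]
  have h1 := key i j
  have h2 := key j i
  rw [← hsym, ht] at h2
  rw [Matrix.add_apply]
  linarith

/-- The section chosen by `extend` matters only modulo `V`, and `σ` does not see this ambiguity when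
its other argument is in `V`. -/
theorem IsFrame.bracket_extend_sub_mem (he : IsFrame V U e) {x : M} (hx : x ∈ U)
    (b : Fin m → ℝ) :
    bracket X (extend V x (∑ i, b i • e i x)) x - ∑ i, b i • bracket X (e i) x ∈ V x := by
  have hv : ∑ i, b i • e i x ∈ V x :=
    Submodule.sum_mem _ fun i _ => Submodule.smul_mem _ _ ((he.isSection i).mem x hx)
  obtain ⟨h1, U', hx', h2⟩ := he.extend_spec hx hv
  exact he.bracket_sub_mem hx h2 hx' h1

/-- The canonical form in a frame. -/
theorem IsRegularSemiHamiltonian.canonicalForm_eq (hq : IsRegularSemiHamiltonian m X V D σ)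
    (he : IsFrame V U e) {x : M} (hx : x ∈ U) (a b : Fin m → ℝ) :
    canonicalForm X V σ x (∑ i, a i • e i x) (∑ i, b i • e i x) =
      dotProduct a ((gram X σ e x).mulVec b) := by
  have hv : ∑ i, b i • e i x ∈ V x :=
    Submodule.sum_mem _ fun i _ => Submodule.smul_mem _ _ ((he.isSection i).mem x hx)
  have h1 := he.bracket_extend_sub_mem (X := X) hx a
  have h2 := hq.lagrangian x _ h1 _ hv
  rw [map_sub, LinearMap.sub_apply, sub_eq_zero] at h2
  rw [canonicalForm, h2]
  simp only [map_sum, map_smul, LinearMap.sum_apply, LinearMap.smul_apply, dotProduct,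
    Matrix.mulVec, smul_eq_mul]
  simp only [Finset.mul_sum]
  rw [Finset.sum_comm]
  refine Finset.sum_congr rfl fun i _ => Finset.sum_congr rfl fun j _ => ?_
  change b j * (a i * _) = a i * (σ x (bracket X (e i) x) (e j x) * b j)
  ring

open Classical in
/-- The vector `u ∈ V x` such that `J - [X, u] ∈ V x`. -/
def verticalPart (X : VField E M) (V : PlaneField E M) (x : M) (J : TangentSpace 𝓘(ℝ, E) x) :
    TangentSpace 𝓘(ℝ, E) x :=
  if h : ∃ u ∈ V x, J - bracket X (extend V x u) x ∈ V x then h.choose else 0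

/-- The map `V → D / V` induced by `[X, ·]` is bijective, so the vertical part is determined by `b`.
Since `verticalPart` involves no frame, it gives one function along the whole curve although frames
are only local. -/
theorem IsRegularSemiHamiltonian.verticalPart_eq (hq : IsRegularSemiHamiltonian m X V D σ)
    (he : IsFrame V U e) {x : M} (hx : x ∈ U) (a b : Fin m → ℝ) :
    verticalPart X V x (∑ i, a i • e i x + ∑ i, b i • bracket X (e i) x) =
      ∑ i, b i • e i x := by
  have hmem : ∀ b : Fin m → ℝ, ∑ i, b i • e i x ∈ V x := fun b =>
    Submodule.sum_mem _ fun i _ => Submodule.smul_mem _ _ ((he.isSection i).mem x hx)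
  set J := ∑ i, a i • e i x + ∑ i, b i • bracket X (e i) x with hJ
  have h : ∃ u ∈ V x, J - bracket X (extend V x u) x ∈ V x := by
    refine ⟨∑ i, b i • e i x, hmem b, ?_⟩
    have h1 := (V x).sub_mem (hmem a) (he.bracket_extend_sub_mem (X := X) hx b)
    convert h1 using 1
    rw [hJ]; abel
  rw [verticalPart, dif_pos h]
  obtain ⟨hu, huJ⟩ := h.choose_spec
  set u := h.choose
  have hu' := hu
  rw [← he.span_eq x hx] at hu'
  obtain ⟨d, hd⟩ := (Submodule.mem_span_range_iff_exists_fun ℝ).1 hu'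
  rw [← hd] at huJ ⊢
  have h2 := (V x).sub_mem ((V x).add_mem huJ (he.bracket_extend_sub_mem (X := X) hx d)) (hmem a)
  rw [← he.span_eq x hx] at h2
  obtain ⟨r, hr⟩ := (Submodule.mem_span_range_iff_exists_fun ℝ).1 h2
  have hinj := injective_sum_smul (hq.linearIndependent_doubleFrame he hx)
  have h3 : Sum.elim r d = Sum.elim (0 : Fin m → ℝ) b := by
    apply hinj
    simp only [sum_doubleFrame, Sum.elim_inl, Sum.elim_inr, hr, hJ, Pi.zero_apply, zero_smul,
      Finset.sum_const_zero]
    abel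
  have h4 : d = b := funext fun i => congrFun h3 (.inr i)
  rw [h4]

end SemiHamiltonian

/-! ### Coordinates of solutions of the variational equation -/

section Coordinates

variable {E : Type*} [NormedAddCommGroup E] [NormedSpace ℝ E]
  {M : Type*} [TopologicalSpace M] [ChartedSpace E M]

theorem hasDerivWithinAt_frameMap {ι : Type*} [Fintype ι] {y : ℝ → ι → E} {y' : ι → E}
    {S : Set ℝ} {s : ℝ} (hy : ∀ i, HasDerivWithinAt (fun s => y s i) (y' i) S s) :
    HasDerivWithinAt (fun s => frameMap (y s)) (frameMap y') S s := by
  refine HasDerivWithinAt.fun_sum fun i _ => ?_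
  exact (ContinuousLinearMap.smulRightL ℝ (ι → ℝ) E
    (ContinuousLinearMap.proj (R := ℝ) (φ := fun _ : ι => ℝ) i)).hasFDerivAt.comp_hasDerivWithinAt
      s (hy i)

variable [IsManifold 𝓘(ℝ, E) ∞ M]

/-- The coordinates, in a frame whose span is invariant under `X`, of a solution of the
variational equation along an integral curve. -/
theorem exists_coords_along [CompleteSpace E] {ι : Type*} [Fintype ι] {X : VField E M}
    {Y : ι → VField E M} {U : Set M} {c : ℝ → M} {p : M} {α β : ℝ} {Q : M → Matrix ι ι ℝ}
    {P : E →L[ℝ] (ι → ℝ)} {J : (s : ℝ) → TangentSpace 𝓘(ℝ, E) (c s)}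
    (hX : SmoothFieldOn X univ) (hU : IsOpen U) (hY : ∀ i, SmoothFieldOn (Y i) U)
    (hQ : ∀ y ∈ U, ∀ k, bracket X (Y k) y = ∑ i, Q y i k • Y i y) (hαβ : α < β)
    (hc : IsMIntegralCurveOn c X (Icc α β)) (hcU : ∀ s ∈ Icc α β, c s ∈ U)
    (hcp : ∀ s ∈ Icc α β, c s ∈ (extChartAt 𝓘(ℝ, E) p).source)
    (hP : ∀ s ∈ Icc α β,
      IsUnit (P ∘L frameMap fun i => chartField p (Y i) (extChartAt 𝓘(ℝ, E) p (c s))))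
    (hJ : ∀ s ∈ Icc α β, HasDerivWithinAt (fun s => chartVec p (c s) (J s))
      (fderiv ℝ (chartField p X) (extChartAt 𝓘(ℝ, E) p (c s)) (chartVec p (c s) (J s)))
      (Icc α β) s)
    (hJα : J α ∈ Submodule.span ℝ (range fun i => Y i (c α))) :
    ∃ a : ℝ → ι → ℝ, ∀ s ∈ Icc α β, J s = ∑ i, a s i • Y i (c s) ∧
      ∀ i, HasDerivWithinAt (fun s => a s i) (-(Q (c s)).mulVec (a s) i) (Icc α β) s := by
  set φ := extChartAt 𝓘(ℝ, E) p with hφ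
  set A : ℝ → E →L[ℝ] E := fun s => fderiv ℝ (chartField p X) (φ (c s)) with hA
  set B : ℝ → (ι → ℝ) →L[ℝ] E := fun s => frameMap fun i => chartField p (Y i) (φ (c s)) with hB
  set C : ℝ → (ι → ℝ) →L[ℝ] (ι → ℝ) := fun s =>
    LinearMap.toContinuousLinearMap (Q (c s)).mulVecLin with hC
  have hcd : ∀ s ∈ Icc α β, HasDerivWithinAt (fun s => φ (c s)) (chartVec p (c s) (X (c s)))
      (Icc α β) s := fun s hs => hasDerivWithinAt_chart_of_isMIntegralCurveOn hc hs (hcp s hs)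
  have hAc : ContinuousOn A (Icc α β) := fun s hs => by
    have h1 := contDiffAt_chartField isOpen_univ hX (mem_univ (c s)) (hcp s hs)
    have h2 : ContinuousAt (fderiv ℝ (chartField p X)) (φ (c s)) :=
      (h1.fderiv_right (m := 0) (by norm_cast)).continuousAt
    exact ContinuousAt.comp_continuousWithinAt (f := fun s => φ (c s)) h2
      (hcd s hs).continuousWithinAt
  have hBapp : ∀ s ∈ Icc α β, ∀ a : ι → ℝ, B s a = chartVec p (c s) (∑ i, a i • Y i (c s)) := by
    intro s hs a
    simp only [hB, frameMap_apply, map_sum, map_smul]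
    refine Finset.sum_congr rfl fun i _ => ?_
    rw [hφ, chartField_apply (hcp s hs)]
  -- In the chart `DY(X) = DX(Y) + [X, Y]`. Along the curve this reads `B' = A B + B C`, with `C`
  -- given by the matrix `Q` of the bracket with `X`.
  have hBd : ∀ s ∈ Icc α β, HasDerivWithinAt B (A s ∘L B s + B s ∘L C s) (Icc α β) s := by
    intro s hs
    have h1 : HasDerivWithinAt B (frameMap fun i =>
        fderiv ℝ (chartField p (Y i)) (φ (c s)) (chartVec p (c s) (X (c s)))) (Icc α β) s := by
      refine hasDerivWithinAt_frameMap fun i => ?_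
      have h2 := (contDiffAt_chartField hU (hY i) (hcU s hs) (hcp s hs)).differentiableAt (by simp)
      exact h2.hasFDerivAt.comp_hasDerivWithinAt s (hcd s hs)
    refine h1.congr_deriv (ContinuousLinearMap.ext fun a => ?_)
    have h3 : ∀ k, fderiv ℝ (chartField p (Y k)) (φ (c s)) (chartVec p (c s) (X (c s))) =
        A s (chartVec p (c s) (Y k (c s))) + chartVec p (c s) (∑ i, Q (c s) i k • Y i (c s)) := by
      intro k
      rw [← hQ _ (hcU s hs), chartVec_bracket hU (hX.mono (subset_univ _)) (hY k) (hcU s hs)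
        (hcp s hs)]
      simp only [hA, hφ]
      abel
    simp only [add_apply, ContinuousLinearMap.comp_apply, hBapp s hs]
    simp only [frameMap_apply, h3, smul_add, Finset.sum_add_distrib]
    congr 1
    · simp only [map_sum, map_smul]
    · simp only [map_sum, map_smul, hC, LinearMap.coe_toContinuousLinearMap',
        Matrix.mulVecLin_apply, Matrix.mulVec, dotProduct, Finset.smul_sum, Finset.sum_smul]
      rw [Finset.sum_comm]
      refine Finset.sum_congr rfl fun i _ => Finset.sum_congr rfl fun k _ => ?_
      rw [smul_smul, mul_comm]
  obtain ⟨a, ha⟩ := exists_coords_of_linear_ode hαβ hAc hBd hJ hP (by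
    obtain ⟨b, hb⟩ := (Submodule.mem_span_range_iff_exists_fun ℝ).1 hJα
    exact ⟨b, by rw [hBapp α (left_mem_Icc.2 hαβ.le), hb]⟩)
  refine ⟨a, fun s hs => ⟨?_, fun i => ?_⟩⟩
  · have h1 := (ha s hs).1
    rw [hBapp s hs] at h1
    exact chartVec_injective (hcp s hs) h1
  · exact (hasDerivWithinAt_pi.1 (ha s hs).2) i

end Coordinates

/-! ### Transported vectors in the frame `e, [X, e]` -/

section JacobiCurve

variable {E : Type*} [NormedAddCommGroup E] [NormedSpace ℝ E] [FiniteDimensional ℝ E]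
  {M : Type*} [TopologicalSpace M] [T2Space M] [ChartedSpace E M] [IsManifold 𝓘(ℝ, E) ∞ M]
  {m : ℕ} {X : VField E M} {V D : PlaneField E M} {σ : FormField E M} {U : Set M}
  {e : Fin m → VField E M} {x₀ : M} {t : ℝ}

/-- The image `exp(sX)_* v` of a tangent vector under the flow. -/
def transport (X : VField E M) (x₀ : M) (v : TangentSpace 𝓘(ℝ, E) x₀) (s : ℝ) :
    TangentSpace 𝓘(ℝ, E) (flow X s x₀) :=
  mfderiv 𝓘(ℝ, E) 𝓘(ℝ, E) (flow X s) x₀ v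

/-- In a local frame `e, [X, e]` of `D`, the transported vectors `e a + [X, e] b` satisfy
`a' = -H₀ b`, `b' = -a - H₁ b`. -/
theorem IsRegularSemiHamiltonian.exists_transport_coords
    (hq : IsRegularSemiHamiltonian m X V D σ) (he : IsFrame V U e)
    (hc : IsMIntegralCurveOn (fun s => flow X s x₀) X (Icc 0 t)) (v : TangentSpace 𝓘(ℝ, E) x₀)
    {s₀ : ℝ} (hs₀ : s₀ ∈ Icc 0 t) (hU : flow X s₀ x₀ ∈ U) :
    ∃ δ > 0, ∀ α ∈ Icc 0 t, s₀ - δ < α → α ≤ s₀ → ∀ β ∈ Icc 0 t, β < s₀ + δ → α < β →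
      transport X x₀ v α ∈ D (flow X α x₀) →
      (∀ s ∈ Icc α β, flow X s x₀ ∈ U) ∧
      ∃ a b : ℝ → Fin m → ℝ, ∀ s ∈ Icc α β,
        transport X x₀ v s = ∑ i, a s i • e i (flow X s x₀) +
          ∑ i, b s i • bracket X (e i) (flow X s x₀) ∧
        (∀ i, HasDerivWithinAt (fun s => a s i)
          (-(matrixH0 X e (flow X s x₀)).mulVec (b s) i) (Icc α β) s) ∧
        ∀ i, HasDerivWithinAt (fun s => b s i)
          (-a s i - (matrixH1 X e (flow X s x₀)).mulVec (b s) i) (Icc α β) s := by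
  classical
  have : CompleteSpace E := FiniteDimensional.complete ℝ E
  have hX := hq.smooth_field
  set c : ℝ → M := fun s => flow X s x₀ with hcdef
  obtain ⟨δ₁, hδ₁, hvar⟩ := variational_equation hX hc (flow_zero hX x₀) v hs₀
  set p := c s₀ with hp
  have hps : p ∈ (extChartAt 𝓘(ℝ, E) p).source := mem_extChartAt_source p
  set B : M → (Fin m ⊕ Fin m → ℝ) →L[ℝ] E := fun y =>
    frameMap fun k => chartField p (doubleFrame X e k) (extChartAt 𝓘(ℝ, E) p y) with hB
  have hsm : ∀ k, SmoothFieldOn (doubleFrame X e k) U := fun k =>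
    (hq.isSection_doubleFrame he k).smooth
  have hinj : Function.Injective (B p) := by
    have h1 : LinearIndependent ℝ fun k => chartVec p p (doubleFrame X e k p) :=
      (hq.linearIndependent_doubleFrame he hU).map' (chartVec p p).toLinearMap
        (LinearMap.ker_eq_bot.2 (chartVec_injective hps))
    intro u w huw
    refine injective_sum_smul h1 ?_
    simp only [hB, frameMap_apply] at huw
    simpa only [chartField_apply hps] using huw
  obtain ⟨P, hP⟩ := exists_leftInverse_near hinj
  have hBc : ContinuousAt B p := by
    refine tendsto_finsetSum _ fun k _ => ?_
    have h1 : ContinuousAt (fun y => chartField p (doubleFrame X e k) (extChartAt 𝓘(ℝ, E) p y)) p :=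
      ContinuousAt.comp (f := extChartAt 𝓘(ℝ, E) p) (g := chartField p (doubleFrame X e k))
        (contDiffAt_chartField he.isOpen (hsm k) hU hps).continuousAt (continuousAt_extChartAt p)
    exact ((ContinuousLinearMap.smulRightL ℝ (Fin m ⊕ Fin m → ℝ) E
      (ContinuousLinearMap.proj (R := ℝ) (φ := fun _ => ℝ) k)).continuous.continuousAt).comp h1
  have hnear : ∀ᶠ s in 𝓝[Icc 0 t] s₀, IsUnit (P ∘L B (c s)) ∧ c s ∈ U :=
    (hc.continuousOn s₀ hs₀).eventually
      ((hBc.eventually hP).and (he.isOpen.mem_nhds hU))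
  obtain ⟨δ₂, hδ₂, hnear⟩ := Metric.mem_nhdsWithin_iff.1 hnear
  refine ⟨min δ₁ δ₂, lt_min hδ₁ hδ₂, fun α hα h1 h2 β hβ h3 h4 hD => ?_⟩
  have hm1 := min_le_left δ₁ δ₂
  have hm2 := min_le_right δ₁ δ₂
  have hsub : Icc α β ⊆ Icc 0 t := Icc_subset_Icc hα.1 hβ.2
  have hn : ∀ s ∈ Icc α β, IsUnit (P ∘L B (c s)) ∧ c s ∈ U := fun s hs =>
    hnear ⟨by rw [Metric.mem_ball, Real.dist_eq, abs_lt]; constructor <;> linarith [hs.1, hs.2],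
      hsub hs⟩
  have hv := hvar α hα (by linarith) h2 β hβ (by linarith)
  -- The matrix of the bracket with `X` in the frame `e, [X, e]`: its block rows are `(0, H₀)` and
  -- `(1, H₁)`.
  set Q : M → Matrix (Fin m ⊕ Fin m) (Fin m ⊕ Fin m) ℝ := fun y =>
    Matrix.of fun i k => Sum.elim (fun j => if i = .inr j then (1 : ℝ) else 0)
      (fun j => structureCoeffs X e y j i) k with hQ
  have hQb : ∀ y ∈ U, ∀ k, bracket X (doubleFrame X e k) y =
      ∑ i, Q y i k • doubleFrame X e i y := by
    rintro y hy (j | j)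
    · simp only [hQ, Matrix.of_apply, Sum.elim_inl, ite_smul, one_smul, zero_smul,
        Finset.sum_ite_eq', Finset.mem_univ, if_true]
      rfl
    · exact hq.bracket_bracket he hy j
  obtain ⟨a, ha⟩ := exists_coords_along (J := transport X x₀ v) hX he.isOpen hsm hQb h4
    (hc.mono hsub) (fun s hs => (hn s hs).2) (fun s hs => (hv s hs).1) (fun s hs => (hn s hs).1)
    (fun s hs => (hv s hs).2) (by
      rw [hq.span_doubleFrame he (hn α (left_mem_Icc.2 h4.le)).2]; exact hD)
  refine ⟨fun s hs => (hn s hs).2, fun s i => a s (.inl i), fun s i => a s (.inr i),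
    fun s hs => ⟨?_, fun i => ?_, fun i => ?_⟩⟩
  · rw [(ha s hs).1, sum_doubleFrame]
  · refine ((ha s hs).2 (.inl i)).congr_deriv ?_
    simp [hQ, Matrix.mulVec, dotProduct, Fintype.sum_sum_type, matrixH0]
  · refine ((ha s hs).2 (.inr i)).congr_deriv ?_
    simp [hQ, Matrix.mulVec, dotProduct, Fintype.sum_sum_type, matrixH1]
    ring

/-- The transported vectors stay in `D`. -/
theorem IsRegularSemiHamiltonian.transport_mem (hq : IsRegularSemiHamiltonian m X V D σ)
    (hc : IsMIntegralCurveOn (fun s => flow X s x₀) X (Icc 0 t)) {v : TangentSpace 𝓘(ℝ, E) x₀}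
    (hv : v ∈ V x₀) : ∀ s ∈ Icc 0 t, transport X x₀ v s ∈ D (flow X s x₀) := by
  have : CompleteSpace E := FiniteDimensional.complete ℝ E
  refine forall_Icc_of_locally_propagates ?_ fun s₀ hs₀ => ?_
  · have h0 : flow X 0 = id := funext (flow_zero hq.smooth_field)
    rw [transport, h0, mfderiv_id]
    exact hq.le x₀ hv
  · obtain ⟨U, hU, he⟩ := localFrame_spec hq.distribution_V (flow X s₀ x₀)
    obtain ⟨δ, hδ, h⟩ := hq.exists_transport_coords he hc v hs₀ hU
    refine ⟨δ, hδ, fun s₁ hs₁ s hs h1 h2 h3 h4 hD => ?_⟩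
    rcases eq_or_lt_of_le h2 with rfl | h2
    · exact hD
    · obtain ⟨hU', a, b, hab⟩ := h s₁ hs₁ h1 h4 s hs h3 h2 hD
      rw [(hab s (right_mem_Icc.2 h2.le)).1]
      have hsU := hU' s (right_mem_Icc.2 h2.le)
      exact (D _).add_mem
        (Submodule.sum_mem _ fun i _ => Submodule.smul_mem _ _
          ((hq.isSection_frame he i).mem _ hsU))
        (Submodule.sum_mem _ fun i _ => Submodule.smul_mem _ _
          ((hq.isSection_bracket (hq.isSection_frame he i)).mem _ hsU))

end JacobiCurve

/-! ### Parallel and definite bilinear forms in coordinates -/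

section Gram

variable {m : ℕ}

theorem hasDerivWithinAt_mulVec {A : ℝ → Matrix (Fin m) (Fin m) ℝ} {x : ℝ → Fin m → ℝ}
    {A' x' : Fin m → ℝ} {S : Set ℝ} {s : ℝ} {i : Fin m}
    (hA : ∀ j, HasDerivWithinAt (fun s => A s i j) (A' j) S s)
    (hx : ∀ j, HasDerivWithinAt (fun s => x s j) (x' j) S s) :
    HasDerivWithinAt (fun s => (A s).mulVec (x s) i) (∑ j, (A' j * x s j + A s i j * x' j)) S s := by
  simp only [Matrix.mulVec, dotProduct]
  exact HasDerivWithinAt.fun_sum fun j _ => (hA j).fun_mul (hx j)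

/-- The Leibniz rule for a bilinear form whose matrix `G` is parallel for the connection with
matrix `H / 2`. -/
theorem hasDerivWithinAt_dotProduct_mulVec {x y : ℝ → Fin m → ℝ}
    {G : ℝ → Matrix (Fin m) (Fin m) ℝ} {H : Matrix (Fin m) (Fin m) ℝ} {ξ η : Fin m → ℝ}
    {S : Set ℝ} {s : ℝ}
    (hx : ∀ i, HasDerivWithinAt (fun s => x s i) (ξ i - 1 / 2 * H.mulVec (x s) i) S s)
    (hy : ∀ i, HasDerivWithinAt (fun s => y s i) (η i - 1 / 2 * H.mulVec (y s) i) S s)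
    (hG : ∀ i j, HasDerivWithinAt (fun s => G s i j)
      (1 / 2 * (H.transpose * G s + G s * H) i j) S s) :
    HasDerivWithinAt (fun s => dotProduct (x s) ((G s).mulVec (y s)))
      (dotProduct ξ ((G s).mulVec (y s)) + dotProduct (x s) ((G s).mulVec η)) S s := by
  have h1 : HasDerivWithinAt (fun s => dotProduct (x s) ((G s).mulVec (y s)))
      (∑ i, ((ξ i - 1 / 2 * H.mulVec (x s) i) * (G s).mulVec (y s) i +
        x s i * ∑ j, ((1 / 2 * (H.transpose * G s + G s * H) i j) * y s j +
          G s i j * (η j - 1 / 2 * H.mulVec (y s) j)))) S s :=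
    HasDerivWithinAt.fun_sum fun i _ => (hx i).fun_mul
      (hasDerivWithinAt_mulVec (hG i) hy)
  refine h1.congr_deriv ?_
  -- The terms with `H` from the derivatives of `x` and `y` cancel those from the derivative of `G`,
  -- once `H` is moved across the pairing as its transpose.
  have h2 : dotProduct (ξ - (1 / 2 : ℝ) • H.mulVec (x s)) ((G s).mulVec (y s)) +
      dotProduct (x s) (((1 / 2 : ℝ) • (H.transpose * G s + G s * H)).mulVec (y s) +
        (G s).mulVec (η - (1 / 2 : ℝ) • H.mulVec (y s))) =
      dotProduct ξ ((G s).mulVec (y s)) + dotProduct (x s) ((G s).mulVec η) := by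
    have h3 : dotProduct (H.mulVec (x s)) ((G s).mulVec (y s)) =
        dotProduct (x s) (H.transpose.mulVec ((G s).mulVec (y s))) := by
      rw [Matrix.dotProduct_mulVec (x s), Matrix.vecMul_transpose]
    simp only [sub_dotProduct, smul_dotProduct, dotProduct_add, dotProduct_sub, dotProduct_smul,
      Matrix.smul_mulVec, Matrix.add_mulVec, Matrix.mulVec_sub, Matrix.mulVec_smul,
      ← Matrix.mulVec_mulVec, h3, smul_eq_mul]
    ring
  rw [← h2]
  simp only [dotProduct, Matrix.mulVec, Pi.add_apply, Pi.sub_apply, Pi.smul_apply, smul_eq_mul,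
    Matrix.smul_apply, Finset.sum_add_distrib]

/-- The Cauchy–Schwarz inequality for a definite symmetric form of either sign. -/
theorem dotProduct_mulVec_sq_le {G : Matrix (Fin m) (Fin m) ℝ} (hG : G.IsSymm)
    (hdef : (∀ x, x ≠ 0 → 0 < dotProduct x (G.mulVec x)) ∨
      ∀ x, x ≠ 0 → dotProduct x (G.mulVec x) < 0) (b w : Fin m → ℝ) :
    dotProduct b (G.mulVec w) ^ 2 ≤ dotProduct b (G.mulVec b) * dotProduct w (G.mulVec w) := by
  rcases eq_or_ne b 0 with rfl | hb
  · simp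
  have hsymm : dotProduct w (G.mulVec b) = dotProduct b (G.mulVec w) := by
    rw [Matrix.dotProduct_mulVec, ← Matrix.mulVec_transpose, hG.eq, dotProduct_comm]
  set q := dotProduct b (G.mulVec b) with hq
  set p := dotProduct b (G.mulVec w) with hp
  set r := dotProduct w (G.mulVec w) with hr
  -- Evaluating the form on `q w - p b` produces a factor `q` whose sign is that of the form, so `q
  -- r - p² ≥ 0` in either case.
  have hz : dotProduct (q • w - p • b) (G.mulVec (q • w - p • b)) = q * (q * r - p ^ 2) := by
    simp only [sub_dotProduct, smul_dotProduct, dotProduct_sub, dotProduct_smul,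
      Matrix.mulVec_sub, Matrix.mulVec_smul, smul_eq_mul, hsymm, ← hq, ← hp, ← hr]
    ring
  rcases hdef with hdef | hdef
  · have h1 : 0 ≤ dotProduct (q • w - p • b) (G.mulVec (q • w - p • b)) := by
      rcases eq_or_ne (q • w - p • b) 0 with h | h
      · simp [h]
      · exact (hdef _ h).le
    rw [hz] at h1
    linarith [nonneg_of_mul_nonneg_right h1 (hdef b hb)]
  · have h1 : dotProduct (q • w - p • b) (G.mulVec (q • w - p • b)) ≤ 0 := by
      rcases eq_or_ne (q • w - p • b) 0 with h | h
      · simp [h]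
      · exact (hdef _ h).le
    rw [hz] at h1
    have h2 : q < 0 := hdef b hb
    nlinarith

end Gram

/-! ### The Jacobi equation and the comparison argument -/

section Comparison

variable {E : Type*} [NormedAddCommGroup E] [NormedSpace ℝ E]
  {M : Type*} [TopologicalSpace M] [ChartedSpace E M] [IsManifold 𝓘(ℝ, E) ∞ M]
  {m : ℕ} {X : VField E M} {V D : PlaneField E M} {σ : FormField E M} {U : Set M}
  {e : Fin m → VField E M}

theorem IsFrame.sum_mem (he : IsFrame V U e) {x : M} (hx : x ∈ U) (b : Fin m → ℝ) :
    ∑ i, b i • e i x ∈ V x :=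
  Submodule.sum_mem _ fun i _ => Submodule.smul_mem _ _ ((he.isSection i).mem x hx)

theorem IsFrame.sum_ne_zero (he : IsFrame V U e) {x : M} (hx : x ∈ U) {b : Fin m → ℝ}
    (hb : b ≠ 0) : ∑ i, b i • e i x ≠ 0 := fun h => hb <|
  injective_sum_smul (he.linearIndependent x hx) (h.trans (by simp))

variable [FiniteDimensional ℝ E]

theorem IsRegularSemiHamiltonian.gram_isSymm (hq : IsRegularSemiHamiltonian m X V D σ)
    (he : IsFrame V U e) {x : M} (hx : x ∈ U) : (gram X σ e x).IsSymm :=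
  Matrix.IsSymm.ext fun i j => hq.gram_symm he hx j i

theorem IsRegularSemiHamiltonian.gram_definite (hq : IsRegularSemiHamiltonian m X V D σ)
    (he : IsFrame V U e) {x : M} (hx : x ∈ U) (hdef : IsDefiniteAt X V σ x) :
    (∀ b, b ≠ 0 → 0 < dotProduct b ((gram X σ e x).mulVec b)) ∨
      ∀ b, b ≠ 0 → dotProduct b ((gram X σ e x).mulVec b) < 0 :=
  hdef.imp
    (fun h b hb => by
      rw [← hq.canonicalForm_eq he hx]; exact h _ (he.sum_mem hx b) (he.sum_ne_zero hx hb))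
    (fun h b hb => by
      rw [← hq.canonicalForm_eq he hx]; exact h _ (he.sum_mem hx b) (he.sum_ne_zero hx hb))

/-- The first two derivatives of the squared length of the vertical part of a Jacobi field given
by its coordinates `a, b` in the frame `e, [X, e]`. -/
theorem IsRegularSemiHamiltonian.hasDerivWithinAt_gram (hq : IsRegularSemiHamiltonian m X V D σ)
    (he : IsFrame V U e) {c : ℝ → M} {S : Set ℝ} (hc : IsMIntegralCurveOn c X S)
    {a b : ℝ → Fin m → ℝ} {s : ℝ} (hs : s ∈ S) (hU : c s ∈ U)
    (ha : ∀ i, HasDerivWithinAt (fun s => a s i) (-(matrixH0 X e (c s)).mulVec (b s) i) S s)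
    (hb : ∀ i, HasDerivWithinAt (fun s => b s i)
      (-a s i - (matrixH1 X e (c s)).mulVec (b s) i) S s) {w : ℝ → Fin m → ℝ}
    (hw : ∀ s i, w s i = -a s i - 1 / 2 * (matrixH1 X e (c s)).mulVec (b s) i) :
    HasDerivWithinAt (fun s => dotProduct (b s) ((gram X σ e (c s)).mulVec (b s)))
        (2 * dotProduct (b s) ((gram X σ e (c s)).mulVec (w s))) S s ∧
      HasDerivWithinAt (fun s => dotProduct (b s) ((gram X σ e (c s)).mulVec (w s)))
        (dotProduct (w s) ((gram X σ e (c s)).mulVec (w s)) -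
          dotProduct ((curvatureMatrix X e (c s)).mulVec (b s))
            ((gram X σ e (c s)).mulVec (b s))) S s := by
  have hsymm : ∀ x y : Fin m → ℝ, dotProduct x ((gram X σ e (c s)).mulVec y) =
      dotProduct y ((gram X σ e (c s)).mulVec x) := fun x y => by
    rw [Matrix.dotProduct_mulVec, ← Matrix.mulVec_transpose, (hq.gram_isSymm he hU).eq,
      dotProduct_comm]
  have hG : ∀ i j, HasDerivWithinAt (fun s => gram X σ e (c s) i j)
      (1 / 2 * ((matrixH1 X e (c s)).transpose * gram X σ e (c s) +
        gram X σ e (c s) * matrixH1 X e (c s)) i j) S s := fun i j => by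
    rw [← hq.derivAlong_gram he hU]
    exact hasDerivWithinAt_comp_of_isMIntegralCurveOn hc hs (hq.mdifferentiableAt_gram he hU i j)
  have hH : ∀ i j, HasDerivWithinAt (fun s => matrixH1 X e (c s) i j)
      (derivAlong X (fun y => matrixH1 X e y i j) (c s)) S s := fun i j =>
    hasDerivWithinAt_comp_of_isMIntegralCurveOn hc hs (hq.mdifferentiableAt_matrixH1 he hU i j)
  -- That is, `w = ∇b` for `∇ = d/ds + H₁ / 2`.
  have hb' : ∀ i, HasDerivWithinAt (fun s => b s i)
      (w s i - 1 / 2 * (matrixH1 X e (c s)).mulVec (b s) i) S s := fun i =>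
    (hb i).congr_deriv (by rw [hw]; ring)
  -- That is, `∇w = -K b`; the terms of `K` are exactly what remains of `-a' - (H₁ b)' / 2` after
  -- splitting off `-H₁ w / 2`.
  have hw' : ∀ i, HasDerivWithinAt (fun s => w s i)
      ((-(curvatureMatrix X e (c s)).mulVec (b s)) i -
        1 / 2 * (matrixH1 X e (c s)).mulVec (w s) i) S s := fun i => by
    have h1 : HasDerivWithinAt (fun s => -a s i - 1 / 2 * (matrixH1 X e (c s)).mulVec (b s) i)
        (-(-(matrixH0 X e (c s)).mulVec (b s) i) - 1 / 2 *
          ∑ j, (derivAlong X (fun y => matrixH1 X e y i j) (c s) * b s j +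
            matrixH1 X e (c s) i j * (w s j - 1 / 2 * (matrixH1 X e (c s)).mulVec (b s) j))) S s :=
      (ha i).fun_neg.fun_sub ((hasDerivWithinAt_mulVec (hH i) hb').const_mul _)
    simp only [hw _ i]
    refine h1.congr_deriv ?_
    have h2 : (matrixH0 X e (c s)).mulVec (b s) - (1 / 2 : ℝ) •
        ((Matrix.of fun i j => derivAlong X (fun y => matrixH1 X e y i j) (c s)).mulVec (b s) +
          (matrixH1 X e (c s)).mulVec (w s - (1 / 2 : ℝ) • (matrixH1 X e (c s)).mulVec (b s))) =
        -(curvatureMatrix X e (c s)).mulVec (b s) -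
          (1 / 2 : ℝ) • (matrixH1 X e (c s)).mulVec (w s) := by
      simp only [curvatureMatrix, Matrix.sub_mulVec, Matrix.add_mulVec, Matrix.neg_mulVec,
        Matrix.smul_mulVec, Matrix.mulVec_sub, Matrix.mulVec_smul, ← Matrix.mulVec_mulVec]
      module
    have h3 := congrFun h2 i
    simp only [Pi.sub_apply, Pi.smul_apply, Pi.add_apply, smul_eq_mul] at h3
    refine Eq.trans ?_ h3
    rw [neg_neg, Finset.sum_add_distrib]
    rfl
  refine ⟨(hasDerivWithinAt_dotProduct_mulVec hb' hb' hG).congr_deriv ?_,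
    (hasDerivWithinAt_dotProduct_mulVec hb' hw' hG).congr_deriv ?_⟩
  · rw [hsymm (w s)]; ring
  · rw [hsymm (b s), neg_dotProduct]; ring

variable [T2Space M] {x₀ : M} {t : ℝ}

/-- The Jacobi field with initial value in `V` is never vertical before the time prescribed by the
upper bound on the directional curvature. -/
theorem IsRegularSemiHamiltonian.transport_notMem (hq : IsRegularSemiHamiltonian m X V D σ)
    (ht : 0 < t) (hc : IsMIntegralCurveOn (fun s => flow X s x₀) X (Icc 0 t)) {lam μ : ℝ}
    (hA : ∀ s ∈ Icc (0 : ℝ) t, IsDefiniteAt X V σ (flow X s x₀))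
    (hB : ∀ s ∈ Icc (0 : ℝ) t, ∀ v ∈ V (flow X s x₀), v ≠ 0 →
      directionalCurvature m X V σ (flow X s x₀) v ≤ lam)
    (hμ : 0 < μ) (hμt : μ * t < Real.pi) (hlam : lam ≤ μ ^ 2)
    {v : TangentSpace 𝓘(ℝ, E) x₀} (hv : v ∈ V x₀) (hv0 : v ≠ 0) :
    transport X x₀ v t ∉ V (flow X t x₀) := by
  have : CompleteSpace E := FiniteDimensional.complete ℝ E
  intro hvt
  have hflow0 : flow X 0 = id := funext (flow_zero hq.smooth_field)
  set u : (s : ℝ) → TangentSpace 𝓘(ℝ, E) (flow X s x₀) := fun s =>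
    verticalPart X V (flow X s x₀) (transport X x₀ v s) with hu
  have hvert : ∀ x : M, ∀ J ∈ V x, verticalPart X V x J = 0 := fun x J hJ => by
    obtain ⟨U, hU, he⟩ := localFrame_spec hq.distribution_V x
    rw [← he.span_eq x hU] at hJ
    obtain ⟨a, rfl⟩ := (Submodule.mem_span_range_iff_exists_fun ℝ).1 hJ
    have h := hq.verticalPart_eq he hU a 0
    simpa using h
  have hform : ∀ x : M, canonicalForm X V σ x 0 0 = 0 := fun x => by
    rw [canonicalForm, map_zero]
  -- If the transported vector were vertical at time `t`, its vertical part, and with it `q`, would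
  -- vanish there.
  refine ne_zero_of_sturm (q := fun s => canonicalForm X V σ (flow X s x₀) (u s) (u s))
    (lam := lam) ht hμ hμt hlam (fun s₀ hs₀ => ?_) ?_
  swap
  · simp only [hu, hvert _ _ hvt, hform]
  obtain ⟨U, hU, he⟩ := localFrame_spec hq.distribution_V (flow X s₀ x₀)
  -- `curvature` at this point is computed in precisely this frame. The curvature bound is used only
  -- at `s₀`, so no change of frame is needed.
  set e := localFrame V m (flow X s₀ x₀) with hedef
  obtain ⟨δ, hδ, h⟩ := hq.exists_transport_coords he hc v hs₀ hU
  have hα : max 0 (s₀ - δ / 2) ∈ Icc 0 t :=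
    ⟨le_max_left _ _, max_le ht.le (by linarith [hs₀.2])⟩
  have hβ : min t (s₀ + δ / 2) ∈ Icc 0 t :=
    ⟨le_min ht.le (by linarith [hs₀.1]), min_le_left _ _⟩
  have hαs : max 0 (s₀ - δ / 2) ≤ s₀ := max_le hs₀.1 (by linarith)
  have hsβ : s₀ ≤ min t (s₀ + δ / 2) := le_min hs₀.2 (by linarith)
  have hαβ : max 0 (s₀ - δ / 2) < min t (s₀ + δ / 2) :=
    max_lt (lt_min ht (by linarith [hs₀.1])) (lt_min (by linarith [hs₀.2]) (by linarith))
  obtain ⟨hU', a, b, hab⟩ := h _ hα (lt_max_of_lt_right (by linarith)) hαs _ hβ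
    (min_lt_of_right_lt (by linarith)) hαβ (hq.transport_mem hc hv _ hα)
  set I := Icc (max 0 (s₀ - δ / 2)) (min t (s₀ + δ / 2)) with hI
  have hs₀I : s₀ ∈ I := ⟨hαs, hsβ⟩
  have hIsub : I ⊆ Icc 0 t := Icc_subset_Icc hα.1 hβ.2
  have hI0 : I ∈ 𝓝[Icc 0 t] s₀ := by
    filter_upwards [self_mem_nhdsWithin, mem_nhdsWithin_of_mem_nhds (Ioo_mem_nhds
      (show s₀ - δ / 2 < s₀ by linarith) (show s₀ < s₀ + δ / 2 by linarith))] with s h1 h2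
    exact ⟨max_le h1.1 h2.1.le, le_min h1.2 h2.2.le⟩
  set w : ℝ → Fin m → ℝ := fun s i =>
    -a s i - 1 / 2 * (matrixH1 X e (flow X s x₀)).mulVec (b s) i with hw
  have hder := fun s (hs : s ∈ I) => hq.hasDerivWithinAt_gram he (hc.mono hIsub) hs (hU' s hs)
    (hab s hs).2.1 (hab s hs).2.2 (w := w) fun _ _ => rfl
  have hus : ∀ s ∈ I, u s = ∑ i, b s i • e i (flow X s x₀) := fun s hs => by
    rw [hu]
    exact (congrArg _ (hab s hs).1).trans (hq.verticalPart_eq he (hU' s hs) (a s) (b s))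
  have hqs : ∀ s ∈ I, canonicalForm X V σ (flow X s x₀) (u s) (u s) =
      dotProduct (b s) ((gram X σ e (flow X s x₀)).mulVec (b s)) := fun s hs => by
    rw [hus s hs, hq.canonicalForm_eq he (hU' s hs)]
  set G := gram X σ e (flow X s₀ x₀) with hG
  set K := curvatureMatrix X e (flow X s₀ x₀) with hK
  have hdef := hq.gram_definite he hU (hA s₀ hs₀)
  refine ⟨fun s => dotProduct (b s) ((gram X σ e (flow X s x₀)).mulVec (w s)),
    dotProduct (w s₀) (G.mulVec (w s₀)) - dotProduct (K.mulVec (b s₀)) (G.mulVec (b s₀)),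
    ?_, ?_, ?_, ?_⟩
  · filter_upwards [eventually_eventually_nhdsWithin.2 hI0, hI0] with s h1 hsI
    exact ((hder s hsI).1.congr hqs (hqs s hsI)).mono_of_mem_nhdsWithin h1
  · exact (hder s₀ hs₀I).2.mono_of_mem_nhdsWithin hI0
  · have hCS := dotProduct_mulVec_sq_le (hq.gram_isSymm he hU) hdef (b s₀) (w s₀)
    simp only [hqs s₀ hs₀I]
    rw [← hG] at hCS ⊢
    rcases eq_or_ne (b s₀) 0 with hb | hb
    · simp [hb]
    have hk := hB s₀ hs₀ _ (he.sum_mem hU (b s₀)) (he.sum_ne_zero hU hb)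
    rw [directionalCurvature, curvature_eq he hU, hq.canonicalForm_eq he hU,
      hq.canonicalForm_eq he hU, ← hedef, ← hG, ← hK] at hk
    have hne : dotProduct (b s₀) (G.mulVec (b s₀)) ≠ 0 :=
      hdef.elim (fun h => (h _ hb).ne') fun h => (h _ hb).ne
    -- Multiplying by `g(b, b)²` rather than by `g(b, b)` clears the denominator whatever the sign
    -- of `g`.
    have h1 := mul_le_mul_of_nonneg_right hk (sq_nonneg (dotProduct (b s₀) (G.mulVec (b s₀))))
    have h2 : dotProduct (K.mulVec (b s₀)) (G.mulVec (b s₀)) /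
        dotProduct (b s₀) (G.mulVec (b s₀)) * dotProduct (b s₀) (G.mulVec (b s₀)) ^ 2 =
        dotProduct (b s₀) (G.mulVec (b s₀)) * dotProduct (K.mulVec (b s₀)) (G.mulVec (b s₀)) := by
      field_simp
    rw [h2] at h1
    linarith
  · intro h0
    have hcoord : transport X x₀ v s₀ = ∑ i, a s₀ i • e i (flow X s₀ x₀) +
      ∑ i, b s₀ i • bracket X (e i) (flow X s₀ x₀) := (hab s₀ hs₀I).1
    have hmem : transport X x₀ v s₀ ∈ V (flow X s₀ x₀) ∧ transport X x₀ v s₀ ≠ 0 := by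
      rw [h0, transport, hflow0, mfderiv_id]
      exact ⟨hv, hv0⟩
    -- At time `0` the vector is vertical and nonzero, so `b = 0` and `w = -a ≠ 0`. Hence `q` and
    -- `p` vanish, while `d = g(w, w)` does not by definiteness.
    have hb0 : b s₀ = 0 := by
      by_contra hb
      exact he.sum_ne_zero hU hb ((hus s₀ hs₀I).symm.trans (hvert _ _ hmem.1))
    have hw0 : w s₀ ≠ 0 := fun hw0 => hmem.2 <| by
      have ha0 : a s₀ = 0 := funext fun i => by
        have := congrFun hw0 i
        simpa [hw, hb0] using this
      rw [hcoord, ha0, hb0]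
      simp
    have hq0 : canonicalForm X V σ (flow X s₀ x₀) (u s₀) (u s₀) = 0 := by
      rw [hqs s₀ hs₀I, hb0, zero_dotProduct]
    have hp0 : dotProduct (b s₀) ((gram X σ e (flow X s₀ x₀)).mulVec (w s₀)) = 0 := by
      rw [hb0, zero_dotProduct]
    rw [hb0]
    refine ⟨?_, ?_, ?_⟩
    · rw [h0] at hq0
      exact hq0
    · rw [h0] at hp0
      exact hp0
    · rw [Matrix.mulVec_zero, zero_dotProduct, sub_zero]
      exact hdef.elim (fun h => (h _ hw0).ne') fun h => (h _ hw0).ne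

end Comparison

end DynamicPair

end

/-! ### The theorem -/

theorem mainTheorem4 {E : Type*} [NormedAddCommGroup E] [NormedSpace ℝ E] [FiniteDimensional ℝ E]
    {M : Type*} [TopologicalSpace M] [T2Space M] [ChartedSpace E M] [IsManifold 𝓘(ℝ, E) ∞ M]
    (m : ℕ) (X : DynamicPair.VField E M) (V D : DynamicPair.PlaneField E M)
    (σ : DynamicPair.FormField E M)
    (hq : DynamicPair.IsRegularSemiHamiltonian m X V D σ)
    (c : ℝ → M) (T : ℝ) (hc : IsMIntegralCurveOn c X (Icc 0 T))
    (hA : ∀ t ∈ Icc (0 : ℝ) T, DynamicPair.IsDefiniteAt X V σ (c t))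
    (lam : ℝ)
    (hB : ∀ t ∈ Icc (0 : ℝ) T, ∀ v ∈ V (c t), v ≠ 0 →
      DynamicPair.directionalCurvature m X V σ (c t) v ≤ lam) :
    (lam ≤ 0 → ∀ t ∈ Ioc (0 : ℝ) T, ¬ DynamicPair.IsConjugateTime X V (c 0) t) ∧
    (0 < lam → ∀ t ∈ Ioo (0 : ℝ) (min T (Real.pi / √lam)),
      ¬ DynamicPair.IsConjugateTime X V (c 0) t) := by
  have : CompleteSpace E := FiniteDimensional.complete ℝ E
  have key : ∀ t ∈ Ioc (0 : ℝ) T, ∀ μ : ℝ, 0 < μ → μ * t < Real.pi → lam ≤ μ ^ 2 →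
      ¬ DynamicPair.IsConjugateTime X V (c 0) t := by
    rintro t ht μ hμ hμt hlam ⟨-, hconj⟩
    have hsub : Icc 0 t ⊆ Icc 0 T := Icc_subset_Icc_right ht.2
    have hflow : ∀ s ∈ Icc 0 t, DynamicPair.flow X s (c 0) = c s := fun s hs =>
      DynamicPair.flow_eq hq.smooth_field hs.1
        (hc.mono ((Icc_subset_Icc_right hs.2).trans hsub))
    -- The curve `c` is replaced by `flow X s (c 0)`, with which it agrees on `[0, t]`, so that
    -- transported vectors live over the right base points.
    have hcurve : IsMIntegralCurveOn (fun s => DynamicPair.flow X s (c 0)) X (Icc 0 t) := by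
      intro s hs
      have h1 := (hc.mono hsub s hs).congr_of_eventuallyEq
        (eventually_of_mem self_mem_nhdsWithin hflow) (hflow s hs)
      rw [← hflow s hs] at h1
      exact h1
    obtain ⟨w, hw, hw0⟩ := (Submodule.ne_bot_iff _).1 hconj
    obtain ⟨⟨v, hv, rfl⟩, hwV⟩ := Submodule.mem_inf.1 hw
    refine hq.transport_notMem ht.1 hcurve (fun s hs => ?_) (fun s hs => ?_) hμ hμt hlam hv ?_ hwV
    · rw [hflow s hs]
      exact hA s (hsub hs)
    · rw [hflow s hs]
      exact hB s (hsub hs)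
    · rintro rfl
      exact hw0 (map_zero _)
  refine ⟨fun hlam t ht => ?_, fun hlam t ht => ?_⟩
  · have hpos : 0 < Real.pi / (2 * t) := div_pos Real.pi_pos (by linarith [ht.1])
    refine key t ht _ hpos ?_ (hlam.trans (sq_nonneg _))
    have h1 : Real.pi / (2 * t) * t = Real.pi / 2 := by
      have := ht.1.ne'
      field_simp
    rw [h1]
    exact half_lt_self Real.pi_pos
  · have hs : 0 < √lam := Real.sqrt_pos.2 hlam
    refine key t ⟨ht.1, (ht.2.trans_le (min_le_left _ _)).le⟩ _ hs ?_ (Real.sq_sqrt hlam.le).ge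
    rw [mul_comm, ← lt_div_iff₀ hs]
    exact ht.2.trans_le (min_le_right _ _)
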